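/- **Setting.** Fix $d,r\in\mathbb N$. For $\mathbf k,\mathbf l,\mathbf m\in\mathbb Z^d$ let $\lambda_{\mathbf k}>0$, $p_{\mathbf k},q_{\mathbf k,\mathbf l,\mathbf m},d_{\mathbf k}\in[0,1]$, $C_f,C_b\ge 0$, and let $B_{\mathbf k,\mathbf l,\mathbf m}:\mathbb C^r\times\mathbb C^r\to\mathbb C^r$ be bilinear with $|B_{\mathbf k,\mathbf l,\mathbf m}(x,y)|\le|x||y|$. Put $q_{\mathbf k}=\sum_{\mathbf l,\mathbf m}q_{\mathbf k,\mathbf l,\mathbf m}$ and assume $p_{\mathbf k}+q_{\mathbf k}+d_{\mathbf k}=1$ for all $\mathbf k$, and $p_{\mathbf k}\to0$, $q_{\mathbf k}\to0$ as $|\mathbf k|\to\infty$. **Branching tree.** Label particles by $\alpha\in\mathscr I=\bigcup_{n\ge0}\{0,1,2\}^n$. Take independent families, i.i.d. over $\alpha$, of mean-one exponential $E_\alpha$, uniform $U_\alpha\in[0,1]$, and, independently over $\mathbf k$, pairs $Y_\alpha(\mathbf k)=(Y^{(1)}_\alpha(\mathbf k),Y^{(2)}_\alpha(\mathbf k))$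 with $\mathsf P[Y_\alpha(\mathbf k)=(\mathbf l,\mathbf m)]=q_{\mathbf k,\mathbf l,\mathbf m}/q_{\mathbf k}$ (arbitrary law if $q_{\mathbf k}=0$). For a root at $\mathbf k$ set $\hat{\mathbf K}_\emptyset=\mathbf k$, $\hat{\mathbf K}_{(\alpha,0)}=\hat{\mathbf K}_\alpha$, $\hat{\mathbf K}_{(\alpha,i)}=Y^{(i)}_\alpha(\hat{\mathbf K}_\alpha)$ for $i=1,2$; birth and death times $\tau^B_\emptyset=0$, $\tau^B_{(\alpha,i)}=\tau^D_\alpha$, $\tau^D_\alpha=\tau^B_\alpha+E_\alpha/\lambda_{\hat{\mathbf K}_\alpha}$. The root exists; the particle $(\alpha,0)$ exists iff $\alpha$ exists and $U_\alpha\le p_{\hat{\mathbf K}_\alpha}$; for $i=1,2$, $(\alpha,i)$ exists iff $\alpha$ exists and $U_\alpha\ge 1-q_{\hat{\mathbf K}_\alpha}$. Put $\mathbf K_\alpha=\hat{\mathbf K}_\alpha$ if $\alpha$ exists and $\mathbf K_\alpha=\Delta$ (a cemetery state) otherwise. Let $\mathsf P_{\mathbf k}$ be the law of $\mathcal T=(\mathbf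 K_\alpha,\tau^B_\alpha,\tau^D_\alpha)_{\alpha\in\mathscr I}$ and $\mathsf E_{\mathbf k}$ its expectation. For a tree $\mathcal T=(\mathbf k_\alpha,s_\alpha,t_\alpha)_\alpha$ let $\pi_i(\mathcal T)=(\mathbf k_{(i,\alpha)},s_{(i,\alpha)}-t_\emptyset,t_{(i,\alpha)}-t_\emptyset)_\alpha$. There is a death at $\emptyset$ if $\mathbf k_{(0)}=\mathbf k_{(1)}=\mathbf k_{(2)}=\Delta$, a flip if only $\mathbf k_{(0)}\ne\Delta$, and a branch if $\mathbf k_{(0)}=\Delta$ and $\mathbf k_{(1)},\mathbf k_{(2)}\neq\Delta$. **Pruned evaluation.** Given an initial condition $\chi(0)=(\chi_{\mathbf k}(0))_{\mathbf k}$ and a forcing $\gamma=(\gamma_{\mathbf k}(t))_{\mathbf k}$, let $R_{n,t}$ ($n\ge0$) be the $\mathbb C^r$-valued evaluations defined, when only finitely many existing particles are born up to time $t$, by following the tree from the root according to $$R_{n,t}(\mathcal T)=\begin{cases}\chi_{\mathbf k_\emptyset}(0)& t_\emptyset\ge t,\\ 0& t_\emptyset<t,\ n=0,\\ \gamma_{\mathbf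 k_\emptyset}(t-t_\emptyset)& t_\emptyset<t,\ n\ge1,\text{ death at }\emptyset,\\ C_f\,R_{n,t-t_\emptyset}(\pi_0(\mathcal T))& t_\emptyset<t,\ n\ge1,\text{ flip at }\emptyset,\\ C_b\,B_{\mathbf k_\emptyset,\mathbf k_{(1)},\mathbf k_{(2)}}\big(R_{n,t-t_\emptyset}(\pi_1(\mathcal T)),R_{n-1,t-t_\emptyset}(\pi_2(\mathcal T))\big)& t_\emptyset<t,\ n\ge1,\text{ branch at }\emptyset,\end{cases}$$ and put $\chi^{(n)}_{\mathbf k}(t)=\mathsf E_{\mathbf k}[R_{n,t}]$. (The remaining trees form a $\mathsf P_{\mathbf k}$-null set.) Write $L^\infty([0,T],\ell^\infty(\mathbb C^r))$ for the families $f=(f_{\mathbf k}(t))$, with each $f_{\mathbf k}$ measurable on $[0,T]$, such that $\sup_{\mathbf k}|f_{\mathbf k}(t)|\le C$ for almost all $t\in[0,T]$ and some $C<\infty$. **Proposition.** Let $T>0$, $\chi(0)\in\ell^\infty(\mathbb C^r)$ and $\gamma\in L^\infty([0,T],\ell^\infty(\mathbb C^r))$. Then for all $n\ge0$, $\mathbf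 k\in\mathbb Z^d$, $t\in[0,T]$ the variable $R_{n,t}$ is $\mathsf P_{\mathbf k}$-integrable, and $(\chi^{(n)})_{n\ge0}$ is the unique sequence of functions in $L^\infty([0,T],\ell^\infty(\mathbb C^r))$ that is a mild solution on $[0,T]$ of the scheme $$\dot\chi^{(0)}_{\mathbf k}=-\lambda_{\mathbf k}\chi^{(0)}_{\mathbf k},\qquad \dot\chi^{(n)}_{\mathbf k}=\lambda_{\mathbf k}\Big[-\chi^{(n)}_{\mathbf k}+C_fp_{\mathbf k}\chi^{(n)}_{\mathbf k}+C_b\sum_{\mathbf l,\mathbf m}q_{\mathbf k,\mathbf l,\mathbf m}B_{\mathbf k,\mathbf l,\mathbf m}(\chi^{(n)}_{\mathbf l},\chi^{(n-1)}_{\mathbf m})+d_{\mathbf k}\gamma_{\mathbf k}\Big]\quad(n\ge1)$$ with $\chi^{(n)}_{\mathbf k}(0)=\chi_{\mathbf k}(0)$ for all $n$ and $\mathbf k$; that is, for all $\mathbf k$ and all $t\in[0,T]$, $\chi^{(0)}_{\mathbf k}(t)=e^{-\lambda_{\mathbf k}t}\chi_{\mathbf k}(0)$ and, for $n\ge1$,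 $$\chi^{(n)}_{\mathbf k}(t)=e^{-\lambda_{\mathbf k}t}\chi_{\mathbf k}(0)+\int_0^t\lambda_{\mathbf k}e^{-\lambda_{\mathbf k}(t-s)}\Big[C_fp_{\mathbf k}\chi^{(n)}_{\mathbf k}(s)+C_b\sum_{\mathbf l,\mathbf m}q_{\mathbf k,\mathbf l,\mathbf m}B_{\mathbf k,\mathbf l,\mathbf m}(\chi^{(n)}_{\mathbf l}(s),\chi^{(n-1)}_{\mathbf m}(s))+d_{\mathbf k}\gamma_{\mathbf k}(s)\Big]ds,$$ the series (for almost every $s$) and the integrals being convergent. As $T$ is arbitrary, this holds globally in time when $\gamma\in L^\infty([0,T],\ell^\infty(\mathbb C^r))$ for every $T>0$. -/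

import Mathlib

open MeasureTheory Filter Set
open scoped ENNReal

noncomputable section

namespace PrunedTree

/-! ### The abstract quadratic system -/

/-- Modes `k ∈ ℤ^d`. -/
abbrev Site (d : ℕ) := Fin d → ℤ

/-- The value space `ℂ^r` with its Hermitian norm. -/
abbrev Val (r : ℕ) := EuclideanSpace ℂ (Fin r)

/-- The constants of the infinite system
`χ_k' = λ_k [-χ_k + C_f p_k χ_k + C_b ∑_{l,m} q_{k,l,m} B_{k,l,m}(χ_l, χ_m) + d_k γ_k]`
and the standing assumptions on them. On `ℤ^d` the limit `|k| → ∞` is the cofinite filter. -/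
structure QuadSystem (d r : ℕ) where
  /-- the rates `λ_k` -/
  rate : Site d → ℝ
  /-- the flipping probabilities `p_k` -/
  p : Site d → ℝ
  /-- the branching probabilities `q_{k,l,m}` -/
  q : Site d → Site d → Site d → ℝ
  /-- the dying probabilities `d_k` -/
  dth : Site d → ℝ
  /-- the flipping constant `C_f` -/
  Cf : ℝ
  /-- the branching constant `C_b` -/
  Cb : ℝ
  /-- the bilinear operators `B_{k,l,m}` -/
  B : Site d → Site d → Site d → (Val r →ₗ[ℂ] Val r →ₗ[ℂ] Val r)
  rate_pos : ∀ k, 0 < rate k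
  p_mem : ∀ k, p k ∈ Icc (0 : ℝ) 1
  q_mem : ∀ k l m, q k l m ∈ Icc (0 : ℝ) 1
  dth_mem : ∀ k, dth k ∈ Icc (0 : ℝ) 1
  Cf_nonneg : 0 ≤ Cf
  Cb_nonneg : 0 ≤ Cb
  norm_B_le : ∀ k l m x y, ‖B k l m x y‖ ≤ ‖x‖ * ‖y‖
  q_summable : ∀ k, Summable fun lm : Site d × Site d => q k lm.1 lm.2
  prob_sum : ∀ k, p k + (∑' lm : Site d × Site d, q k lm.1 lm.2) + dth k = 1
  p_tendsto : Tendsto p cofinite (nhds 0)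
  q_tendsto : Tendsto (fun k => ∑' lm : Site d × Site d, q k lm.1 lm.2) cofinite (nhds 0)

variable {d r : ℕ}

/-- The total branching probability `q_k = ∑_{l,m} q_{k,l,m}`. -/
def QuadSystem.qtot (S : QuadSystem d r) (k : Site d) : ℝ :=
  ∑' lm : Site d × Site d, S.q k lm.1 lm.2

/-! ### Labels, trees and shifts -/

/-- Particle labels: finite words over `{0,1,2}`, stored with the most recent letter first.
So `[]` is the root, the child `(α, i)` of `α` is `i :: α`, and `(i, α)` is `α ++ [i]`. -/
abbrev Label := List (Fin 3)

/-- Positions: a site, or the cemetery state `none`. -/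
abbrev Position (d : ℕ) := Option (Site d)

instance : MeasurableSpace (Position d) := ⊤

/-- The space of trees `(k_α, s_α, t_α)_α` (position, birth time, death time), with the product
σ-algebra. -/
abbrev Tree (d : ℕ) := Label → Position d × ℝ × ℝ

/-- The position `k_α`. -/
def pos (T : Tree d) (α : Label) : Position d := (T α).1

/-- The birth time `s_α`. -/
def birth (T : Tree d) (α : Label) : ℝ := (T α).2.1

/-- The death time `t_α`. -/
def death (T : Tree d) (α : Label) : ℝ := (T α).2.2

/-- The shift `π_i`: the tree of descendants of the particle `(i)`, with times measured from the
death of the root. -/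
def shift (i : Fin 3) (T : Tree d) : Tree d := fun α =>
  (pos T (α ++ [i]), birth T (α ++ [i]) - death T [], death T (α ++ [i]) - death T [])

/-! ### The branching tree and its law -/

/-- The randomness attached to one label: an exponential clock, a uniform variable, and for every
site a pair of offspring positions. -/
abbrev Mark (d : ℕ) := ℝ × unitInterval × (Site d → Site d × Site d)

/-- A realization of all the marks. -/
abbrev Noise (d : ℕ) := Label → Mark d

/-- The law of the offspring positions of a particle at `k`: the pair `(l, m)` has probability
`q_{k,l,m} / q_k`. (If `q_k = 0` then no branching happens at `k`, and the value is arbitrary.) -/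
def offspringLaw (S : QuadSystem d r) (k : Site d) : PMF (Site d × Site d) :=
  open Classical in
  if h : (∑' lm : Site d × Site d, ENNReal.ofReal (S.q k lm.1 lm.2)) ≠ 0 ∧
      (∑' lm : Site d × Site d, ENNReal.ofReal (S.q k lm.1 lm.2)) ≠ ∞ then
    PMF.normalize (fun lm : Site d × Site d => ENNReal.ofReal (S.q k lm.1 lm.2)) h.1 h.2
  else PMF.pure 0

instance expMeasure_one_isProbabilityMeasure :
    IsProbabilityMeasure (ProbabilityTheory.expMeasure 1) :=
  ProbabilityTheory.isProbabilityMeasure_expMeasure one_pos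

/-- The law of one mark: independent mean-one exponential clock, uniform variable on `[0,1]`, and
offspring positions. -/
def markLaw (S : QuadSystem d r) : Measure (Mark d) :=
  (ProbabilityTheory.expMeasure 1).prod
    ((volume : Measure unitInterval).prod
      (Measure.infinitePi fun k : Site d => (offspringLaw S k).toMeasure))

instance (S : QuadSystem d r) : IsProbabilityMeasure (markLaw S) := by
  unfold markLaw; infer_instance

/-- The law of the noise: i.i.d. marks over all labels. -/
def noiseLaw (S : QuadSystem d r) : Measure (Noise d) :=
  Measure.infinitePi fun _ : Label => markLaw S

instance (S : QuadSystem d r) : IsProbabilityMeasure (noiseLaw S) := by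
  unfold noiseLaw; infer_instance

/-- The positions `K̂_α` in the complete tree rooted at `k` (before deciding which particles
exist). -/
def fullPos (k : Site d) (ω : Noise d) : Label → Site d
  | [] => k
  | i :: α =>
    if i = 0 then fullPos k ω α
    else if i = 1 then ((ω α).2.2 (fullPos k ω α)).1
    else ((ω α).2.2 (fullPos k ω α)).2

/-- The death times: a particle lives for an exponential time of rate `λ` at its own position. -/
def deathTime (S : QuadSystem d r) (k : Site d) (ω : Noise d) : Label → ℝ
  | [] => (S.rate k)⁻¹ * (ω []).1
  | i :: α => deathTime S k ω α + (S.rate (fullPos k ω (i :: α)))⁻¹ * (ω (i :: α)).1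

/-- The birth times: a particle is born when its parent dies. -/
def birthTime (S : QuadSystem d r) (k : Site d) (ω : Noise d) : Label → ℝ
  | [] => 0
  | _ :: α => deathTime S k ω α

/-- The particle `α` exists: along its history the letter `0` was chosen only at flips
(`U ∈ [0, p]`) and the letters `1`, `2` only at branchings (`U ∈ [1 - q, 1]`). -/
def IsPresent (S : QuadSystem d r) (k : Site d) (ω : Noise d) : Label → Prop
  | [] => True
  | i :: α => IsPresent S k ω α ∧
    if i = 0 then ((ω α).2.1 : ℝ) ≤ S.p (fullPos k ω α)
    else 1 - S.qtot (fullPos k ω α) ≤ ((ω α).2.1 : ℝ)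

/-- The branching tree `𝒯_k` rooted at `k`, as a function of the noise. -/
def branchingTree (S : QuadSystem d r) (k : Site d) (ω : Noise d) : Tree d := fun α =>
  (open Classical in if IsPresent S k ω α then some (fullPos k ω α) else none,
    birthTime S k ω α, deathTime S k ω α)

theorem measurable_fullPos (k : Site d) (α : Label) :
    Measurable fun ω : Noise d => fullPos k ω α := by
  induction α with
  | nil => exact measurable_const
  | cons i α ih =>
    have h : Measurable fun ω : Noise d => (ω α).2.2 (fullPos k ω α) := by
      refine (measurable_from_prod_countable_left (f := fun x : (Site d → Site d × Site d) × Site d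
        => x.1 x.2) fun k => measurable_pi_apply k).comp (Measurable.prodMk ?_ ih)
      exact (measurable_pi_apply α).snd.snd
    unfold fullPos
    split_ifs
    exacts [ih, h.fst, h.snd]

theorem measurable_deathTime (S : QuadSystem d r) (k : Site d) (α : Label) :
    Measurable fun ω : Noise d => deathTime S k ω α := by
  induction α with
  | nil => exact ((measurable_pi_apply []).fst).const_mul _
  | cons i α ih =>
    exact ih.add (((measurable_of_countable fun k => (S.rate k)⁻¹).comp
      (measurable_fullPos k (i :: α))).mul (measurable_pi_apply (i :: α)).fst)

theorem measurableSet_isPresent (S : QuadSystem d r) (k : Site d) (α : Label) :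
    MeasurableSet {ω : Noise d | IsPresent S k ω α} := by
  induction α with
  | nil => exact MeasurableSet.univ
  | cons i α ih =>
    have hU : Measurable fun ω : Noise d => ((ω α).2.1 : ℝ) :=
      measurable_subtype_coe.comp (measurable_pi_apply α).snd.fst
    have hp (f : Site d → ℝ) : Measurable fun ω : Noise d => f (fullPos k ω α) :=
      (measurable_of_countable f).comp (measurable_fullPos k α)
    by_cases hi : i = 0
    · simp only [IsPresent, hi, if_true]
      exact ih.inter (measurableSet_le hU (hp _))
    · simp only [IsPresent, hi, if_false]
      exact ih.inter (measurableSet_le (measurable_const.sub (hp _)) hU)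

theorem measurable_branchingTree (S : QuadSystem d r) (k : Site d) :
    Measurable (branchingTree S k) := by
  refine measurable_pi_lambda _ fun α => Measurable.prodMk ?_ (Measurable.prodMk ?_ ?_)
  · exact Measurable.ite (measurableSet_isPresent S k α)
      ((measurable_of_countable some).comp (measurable_fullPos k α)) measurable_const
  · cases α with
    | nil => exact measurable_const
    | cons i α => exact measurable_deathTime S k α
  · exact measurable_deathTime S k α

/-- The law `P_k` of the branching tree rooted at `k`. -/
def treeLaw (S : QuadSystem d r) (k : Site d) : Measure (Tree d) :=
  (noiseLaw S).map (branchingTree S k)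

instance (S : QuadSystem d r) (k : Site d) : IsProbabilityMeasure (treeLaw S k) :=
  Measure.isProbabilityMeasure_map (measurable_branchingTree S k).aemeasurable

/-! ### The pruned evaluation -/

/-- The particles born up to time `t`. -/
def bornBefore (t : ℝ) (T : Tree d) : Set Label := {α | pos T α ≠ none ∧ birth T α ≤ t}

/-- Genealogical consistency of a tree: particles are born when their parent dies, not before
their parent is born, and have a parent. -/
structure Consistent (T : Tree d) : Prop where
  birth_cons : ∀ i α, birth T (i :: α) = death T α
  birth_root : birth T [] ≤ death T []
  parent : ∀ i α, pos T (i :: α) ≠ none → pos T α ≠ none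
  times : ∀ i α, death T α ≤ death T (i :: α)

/-- The approximations from which the pruned evaluation is built: the recursion for `R_{n,t}`
stopped (with value `0`) after `N` generations. The branches of the definition are, in order:
root absent; root alive at time `t`; pruning (label `0`); death; flip; branching. -/
def evalApprox (S : QuadSystem d r) (χ₀ : Site d → Val r) (γ : Site d → ℝ → Val r) :
    ℕ → ℕ → ℝ → Tree d → Val r
  | 0, _, _, _ => 0
  | N + 1, n, t, T =>
    match pos T [] with
    | none => 0
    | some k =>
      if t ≤ death T [] then χ₀ k
      else match n with
        | 0 => 0
        | n + 1 =>
          match pos T [0], pos T [1], pos T [2] with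
          | none, none, none => γ k (t - death T [])
          | some _, none, none =>
              S.Cf • evalApprox S χ₀ γ N (n + 1) (t - death T []) (shift 0 T)
          | none, some l, some m =>
              S.Cb • S.B k l m (evalApprox S χ₀ γ N (n + 1) (t - death T []) (shift 1 T))
                (evalApprox S χ₀ γ N n (t - death T []) (shift 2 T))
          | _, _, _ => 0

/-- The pruned evaluation `R_{n,t}(T)`: the eventual value of the approximations, which exists as
soon as finitely many particles are born up to time `t` (and `0` if there is none). -/
def prunedEval (S : QuadSystem d r) (χ₀ : Site d → Val r) (γ : Site d → ℝ → Val r)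
    (n : ℕ) (t : ℝ) (T : Tree d) : Val r :=
  open Classical in
  if h : ∃ v, ∀ᶠ N in atTop, evalApprox S χ₀ γ N n t T = v then h.choose else 0

theorem consistent_branchingTree (S : QuadSystem d r) (k : Site d) (ω : Noise d)
    (hω : ∀ α, 0 ≤ (ω α).1) : Consistent (branchingTree S k ω) where
  birth_cons _ _ := rfl
  birth_root := mul_nonneg (inv_nonneg.2 (S.rate_pos k).le) (hω [])
  parent i α h := by
    have h' : IsPresent S k ω (i :: α) := by
      by_contra hc
      exact h (if_neg hc)
    simp [pos, branchingTree, h'.1]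
  times i α := le_add_of_nonneg_right
    (mul_nonneg (inv_nonneg.2 (S.rate_pos _).le) (hω (i :: α)))

theorem Consistent.shift {T : Tree d} (hT : Consistent T) (i : Fin 3) :
    Consistent (shift i T) where
  birth_cons j α := by
    have := hT.birth_cons j (α ++ [i])
    simp only [birth, death, PrunedTree.shift, List.cons_append] at this ⊢
    rw [this]
  birth_root := by
    have h1 := hT.birth_cons i []
    have h2 := hT.times i []
    simp only [birth, death, PrunedTree.shift, List.nil_append] at h1 h2 ⊢
    linarith
  parent j α := hT.parent j (α ++ [i])
  times j α := by
    have := hT.times j (α ++ [i])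
    simp only [death, PrunedTree.shift, List.cons_append] at this ⊢
    linarith

theorem bornBefore_shift {t : ℝ} {T : Tree d} (hT : Consistent T)
    (hfin : (bornBefore t T).Finite) (h0 : pos T [] ≠ none) (ht : death T [] < t) (i : Fin 3) :
    (bornBefore (t - death T []) (shift i T)).Finite ∧
      (bornBefore (t - death T []) (shift i T)).ncard < (bornBefore t T).ncard := by
  have hinj : Function.Injective fun α : Label => α ++ [i] :=
    fun _ _ h => List.append_cancel_right h
  have hsub : (fun α : Label => α ++ [i]) '' bornBefore (t - death T []) (shift i T) ⊆
      bornBefore t T \ {[]} := by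
    rintro _ ⟨α, ⟨h1, h2⟩, rfl⟩
    refine ⟨⟨h1, ?_⟩, by simp⟩
    exact (sub_le_sub_iff_right _).1 h2
  have hmem : [] ∈ bornBefore t T := ⟨h0, hT.birth_root.trans ht.le⟩
  refine ⟨Finite.of_finite_image ((hfin.subset sdiff_subset).subset hsub) hinj.injOn, ?_⟩
  rw [← ncard_image_of_injective _ hinj]
  exact (ncard_le_ncard hsub (hfin.subset sdiff_subset)).trans_lt
    (ncard_sdiff_singleton_lt_of_mem hmem hfin)

/-- On a consistent tree with finitely many particles born up to time `t`, the approximations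
stabilize. -/
theorem evalApprox_stable (S : QuadSystem d r) (χ₀ : Site d → Val r)
    (γ : Site d → ℝ → Val r) (N : ℕ) : ∀ (M n : ℕ) (t : ℝ) (T : Tree d), Consistent T →
      (bornBefore t T).Finite → (bornBefore t T).ncard < N → (bornBefore t T).ncard < M →
      evalApprox S χ₀ γ N n t T = evalApprox S χ₀ γ M n t T := by
  induction N with
  | zero => intro M n t T _ _ h; exact absurd h (Nat.not_lt_zero _)
  | succ N ih =>
    intro M n t T hT hfin hN hM
    obtain ⟨M, rfl⟩ : ∃ M', M = M' + 1 := ⟨M - 1, by omega⟩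
    rcases h0 : pos T [] with _ | k
    · simp [evalApprox, h0]
    by_cases ht : t ≤ death T []
    · simp [evalApprox, h0, ht]
    have key (i : Fin 3) (n : ℕ) : evalApprox S χ₀ γ N n (t - death T []) (shift i T) =
        evalApprox S χ₀ γ M n (t - death T []) (shift i T) := by
      obtain ⟨h1, h2⟩ := bornBefore_shift hT hfin (by simp [h0]) (not_le.1 ht) i
      exact ih M n _ _ (hT.shift i) h1 (by omega) (by omega)
    cases n with
    | zero => simp [evalApprox, h0, ht]
    | succ n => simp only [evalApprox, h0, ht, if_false, key]

/-- The approximations eventually equal the pruned evaluation. -/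
theorem eventually_evalApprox_eq (S : QuadSystem d r) (χ₀ : Site d → Val r)
    (γ : Site d → ℝ → Val r) {t : ℝ} {T : Tree d} (hT : Consistent T)
    (hfin : (bornBefore t T).Finite) (n : ℕ) :
    ∀ᶠ N in atTop, evalApprox S χ₀ γ N n t T = prunedEval S χ₀ γ n t T := by
  have h : ∃ v, ∀ᶠ N in atTop, evalApprox S χ₀ γ N n t T = v := by
    refine ⟨evalApprox S χ₀ γ ((bornBefore t T).ncard + 1) n t T,
      (eventually_gt_atTop (bornBefore t T).ncard).mono fun N hN => ?_⟩
    exact evalApprox_stable S χ₀ γ N ((bornBefore t T).ncard + 1) n t T hT hfin hN (by omega)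
  rw [prunedEval, dif_pos h]
  exact h.choose_spec

/-- The implicit relations that characterize the pruned evaluations. -/
theorem prunedEval_implicit (S : QuadSystem d r) (χ₀ : Site d → Val r)
    (γ : Site d → ℝ → Val r) {t : ℝ} {T : Tree d} (hT : Consistent T)
    (hfin : (bornBefore t T).Finite) {k : Site d} (hk : pos T [] = some k) :
    (t ≤ death T [] → ∀ n, prunedEval S χ₀ γ n t T = χ₀ k) ∧
    (death T [] < t → prunedEval S χ₀ γ 0 t T = 0 ∧ ∀ n,
      (pos T [0] = none → pos T [1] = none → pos T [2] = none →
        prunedEval S χ₀ γ (n + 1) t T = γ k (t - death T [])) ∧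
      (pos T [0] ≠ none → pos T [1] = none → pos T [2] = none →
        prunedEval S χ₀ γ (n + 1) t T =
          S.Cf • prunedEval S χ₀ γ (n + 1) (t - death T []) (shift 0 T)) ∧
      (∀ l m, pos T [0] = none → pos T [1] = some l → pos T [2] = some m →
        prunedEval S χ₀ γ (n + 1) t T =
          S.Cb • S.B k l m (prunedEval S χ₀ γ (n + 1) (t - death T []) (shift 1 T))
            (prunedEval S χ₀ γ n (t - death T []) (shift 2 T)))) := by
  have ev (n : ℕ) := (tendsto_add_atTop_nat 1).eventually
    (eventually_evalApprox_eq S χ₀ γ hT hfin n)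
  refine ⟨fun ht n => ?_, fun ht => ⟨?_, fun n => ?_⟩⟩
  · obtain ⟨N, hN⟩ := (ev n).exists
    simp [← hN, evalApprox, hk, ht]
  · obtain ⟨N, hN⟩ := (ev 0).exists
    simp [← hN, evalApprox, hk, ht.not_ge]
  · have evs (i : Fin 3) (n : ℕ) := eventually_evalApprox_eq S χ₀ γ (hT.shift i)
      (bornBefore_shift hT hfin (by simp [hk]) ht i).1 n
    obtain ⟨N, ⟨⟨hN, h0⟩, h1⟩, h2⟩ :=
      ((((ev (n + 1)).and (evs 0 (n + 1))).and (evs 1 (n + 1))).and (evs 2 n)).exists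
    refine ⟨fun a b c => ?_, fun a b c => ?_, fun l m a b c => ?_⟩
    · simp [← hN, evalApprox, hk, ht.not_ge, a, b, c]
    · obtain ⟨j, hj⟩ := Option.ne_none_iff_exists'.1 a
      simp [← hN, evalApprox, hk, ht.not_ge, hj, b, c, h0]
    · simp [← hN, evalApprox, hk, ht.not_ge, a, b, c, h1, h2]

/-- The pruned expectation `χ^{(n)}_k(t) = E_k[R_{n,t}]`. -/
def prunedExpectation (S : QuadSystem d r) (χ₀ : Site d → Val r) (γ : Site d → ℝ → Val r)
    (n : ℕ) (k : Site d) (t : ℝ) : Val r :=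
  ∫ T, prunedEval S χ₀ γ n t T ∂(treeLaw S k)

/-! ### Mild solutions of the semi-implicit scheme -/

/-- `f ∈ L^∞([0,T], ℓ^∞(ℂ^r))`: each mode is measurable in time, and all modes are bounded by a
common constant for almost every time. -/
def MemLinfty (T : ℝ) (f : Site d → ℝ → Val r) : Prop :=
  (∀ k, AEStronglyMeasurable (f k) (volume.restrict (Icc 0 T))) ∧
    ∃ C : ℝ, ∀ᵐ t ∂(volume.restrict (Icc 0 T)), ∀ k, ‖f k t‖ ≤ C

/-- The quadratic summand `q_{k,l,m} B_{k,l,m}(u_l, v_m)`. -/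
def quadTerm (S : QuadSystem d r) (k : Site d) (u v : Site d → Val r)
    (lm : Site d × Site d) : Val r :=
  S.q k lm.1 lm.2 • S.B k lm.1 lm.2 (u lm.1) (v lm.2)

/-- The source
`λ_k e^{-λ_k (t-s)} [C_f p_k u_k(s) + C_b ∑_{l,m} q_{k,l,m} B_{k,l,m}(u_l(s), v_m(s)) + d_k γ_k(s)]`
of the mild formulation. -/
def mildSource (S : QuadSystem d r) (γ u v : Site d → ℝ → Val r) (k : Site d) (t s : ℝ) : Val r :=
  (S.rate k * Real.exp (-(S.rate k * (t - s)))) •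
    ((S.Cf * S.p k) • u k s
      + S.Cb • ∑' lm : Site d × Site d, quadTerm S k (fun l => u l s) (fun m => v m s) lm
      + S.dth k • γ k s)

/-- `χ = (χ^{(n)}_k)` is an `L^∞([0,T], ℓ^∞)` mild solution, with initial condition `χ₀`, of
`χ^{(0)}_k' = -λ_k χ^{(0)}_k` and, for `n ≥ 1`,
`χ^{(n)}_k' = λ_k [-χ^{(n)}_k + C_f p_k χ^{(n)}_k
  + C_b ∑_{l,m} q_{k,l,m} B_{k,l,m}(χ^{(n)}_l, χ^{(n-1)}_m) + d_k γ_k]`.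
The series and integrals in the mild formulation are required to converge. -/
structure IsMildSchemeSolution (S : QuadSystem d r) (χ₀ : Site d → Val r)
    (γ : Site d → ℝ → Val r) (T : ℝ) (χ : ℕ → Site d → ℝ → Val r) : Prop where
  memLinfty : ∀ n, MemLinfty T (χ n)
  zero_eq : ∀ k, ∀ t ∈ Icc 0 T, χ 0 k t = Real.exp (-(S.rate k * t)) • χ₀ k
  summable : ∀ n k, ∀ᵐ s ∂(volume.restrict (Icc 0 T)),
    Summable (quadTerm S k (fun l => χ (n + 1) l s) (fun m => χ n m s))
  integrable : ∀ n k, ∀ t ∈ Icc 0 T,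
    IntervalIntegrable (mildSource S γ (χ (n + 1)) (χ n) k t) volume 0 t
  succ_eq : ∀ n k, ∀ t ∈ Icc 0 T,
    χ (n + 1) k t = Real.exp (-(S.rate k * t)) • χ₀ k
      + ∫ s in (0 : ℝ)..t, mildSource S γ (χ (n + 1)) (χ n) k t s

end PrunedTree

end

open MeasureTheory Filter Set
open scoped ENNReal

noncomputable section

namespace PrunedTree

variable {d r : ℕ}

/-! ### Splitting the noise at the root -/

/-! The proof is a first-step analysis at the root. The noise splits into the clock of the root, its
uniform variable and offspring pair, and three independent copies of the whole noise
(`measurePreserving_root`). The subtree of an existing child is the branching tree built from the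
corresponding copy (`shift_branchingTree`). Hence, almost surely, the evaluation is the initial
value if the root outlives `t`, and otherwise one step of the recursion applied to independent
evaluations (`ae_prunedOn`). Taking expectations, the independence of the two subtrees takes the
expectation inside `B`, the offspring law produces the series, and the clock produces the kernel `λ
e^{-λ(t-s)}` (`integral_stepVal`, `integral_renewal`). This is the mild equation.

All estimates rest on one contraction, `QuadSystem.exists_contraction`. Weighting time by `e^{βt}`
turns one exponential lifetime into the factor `λ_k / (λ_k + β)`. Since `p_k + q_k` tends to zero,
the coefficient `A (p_k + q_k)` is already small for all but finitely many modes, and a large `β`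
handles the remaining ones, whatever the growth of the rates. It is used three times: - with `A =
2`, the probability that generation `N` is reached by time `t` is at most `2^{-N} e^{βt}`, so only
finitely many particles are born and the evaluation is defined almost surely
(`ae_finite_bornBefore`); - with `A = C_f + C_b M`, where `M` bounds the first moment at level `n`,
it bounds the first moment at level `n + 1` (`exists_approxOn_bound`); pruning matters here, because
it makes the estimate linear in the unknown moment instead of quadratic; - with a constant of the
same kind, it halves the weighted distance between two solutions at level `n + 1` once they agree at
level `n` (`IsMildSchemeSolution.unique`).

The moment bounds are proved for the evaluations cut off at depth `N`, uniformly in `N`, and pass to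
the limit by Fatou's lemma. A forcing known only up to a null set of times is replaced by a bounded
measurable version. Death times have absolutely continuous laws, so almost surely no evaluation
notices the change (`ae_prunedEval_congr`). -/

/-- The noise seen by the descendants of the particle `(i)`. -/
def shiftNoise (i : Fin 3) (ω : Noise d) : Noise d := fun α => ω (α ++ [i])

theorem measurable_shiftNoise (i : Fin 3) : Measurable (shiftNoise (d := d) i) :=
  measurable_pi_lambda _ fun _ => measurable_pi_apply _

/-- Glue a root value and three families into one family over all labels. -/
def graft {X : Type*} (x : X × (Label → X) × (Label → X) × (Label → X)) : Label → X := fun α =>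
  if h : α = [] then x.1
  else if α.getLast h = 0 then x.2.1 α.dropLast
  else if α.getLast h = 1 then x.2.2.1 α.dropLast
  else x.2.2.2 α.dropLast

theorem measurable_graft {X : Type*} [MeasurableSpace X] : Measurable (graft (X := X)) := by
  refine measurable_pi_lambda _ fun α => ?_
  unfold graft
  split_ifs
  · exact measurable_fst
  · exact (measurable_pi_apply _).comp (measurable_fst.comp measurable_snd)
  · exact (measurable_pi_apply _).comp (measurable_fst.comp (measurable_snd.comp measurable_snd))
  · exact (measurable_pi_apply _).comp (measurable_snd.comp (measurable_snd.comp measurable_snd))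

/-- The last stored letter of a nonempty word is its first genealogical step, so the labels are the
disjoint union of the root and three copies of themselves. -/
theorem prod_label {M : Type*} [CommMonoid M] (s : Finset Label) (f : Label → M) :
    ∏ α ∈ s, f α = (if [] ∈ s then f [] else 1) *
      ((∏ α ∈ s.preimage (· ++ [(0 : Fin 3)]) (List.append_left_injective _).injOn, f (α ++ [0])) *
      ((∏ α ∈ s.preimage (· ++ [(1 : Fin 3)]) (List.append_left_injective _).injOn, f (α ++ [1])) *
      (∏ α ∈ s.preimage (· ++ [(2 : Fin 3)]) (List.append_left_injective _).injOn, f (α ++ [2]))))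
    := by
  classical
  rw [Finset.prod_preimage' (fun α : Label => α ++ [0]) s _ f,
    Finset.prod_preimage' (fun α : Label => α ++ [1]) s _ f,
    Finset.prod_preimage' (fun α : Label => α ++ [2]) s _ f]
  have hr (i j : Fin 3) (β : Label) : β ++ [j] ∈ range (· ++ [i] : Label → Label) ↔ j = i := by
    constructor
    · rintro ⟨y, hy⟩
      exact (List.append_inj_right' hy rfl |> List.singleton_inj.1).symm
    · rintro rfl
      exact ⟨β, rfl⟩
  rw [← Finset.prod_ite_eq' s [] f]
  simp only [Finset.prod_filter, ← Finset.prod_mul_distrib]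
  refine Finset.prod_congr rfl fun α _ => ?_
  rcases List.eq_nil_or_concat α with rfl | ⟨β, i, rfl⟩
  · simp
  · simp only [List.concat_eq_append, hr]
    fin_cases i <;> simp

/-- An infinite product measure is determined by its values on finite boxes. The preimage of a box
under `graft` is a product of four boxes, and `prod_label` regroups the factors. -/
theorem map_graft {X : Type*} [MeasurableSpace X] (μ : Measure X) [IsProbabilityMeasure μ] :
    (μ.prod ((Measure.infinitePi fun _ : Label => μ).prod
      ((Measure.infinitePi fun _ : Label => μ).prod (Measure.infinitePi fun _ : Label => μ)))).map
        graft = Measure.infinitePi fun _ : Label => μ := by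
  classical
  refine Measure.eq_infinitePi _ fun s t ht => ?_
  rw [Measure.map_apply measurable_graft (MeasurableSet.pi s.countable_toSet fun i _ => ht i)]
  have h (i : Fin 3) : Function.Injective (· ++ [i] : Label → Label) :=
    List.append_left_injective _
  have hset : graft ⁻¹' (s : Set Label).pi t =
      (if [] ∈ s then t [] else univ) ×ˢ
        ((s.preimage (· ++ [0]) (h 0).injOn : Set Label).pi fun α => t (α ++ [0])) ×ˢ
        ((s.preimage (· ++ [1]) (h 1).injOn : Set Label).pi fun α => t (α ++ [1])) ×ˢ
        ((s.preimage (· ++ [2]) (h 2).injOn : Set Label).pi fun α => t (α ++ [2])) := by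
    ext ⟨x, y0, y1, y2⟩
    simp only [mem_preimage, Set.mem_pi, Finset.mem_coe, mem_prod, Finset.mem_preimage]
    constructor
    · intro H
      refine ⟨?_, fun α hα => ?_, fun α hα => ?_, fun α hα => ?_⟩
      · split_ifs with hn
        · simpa [graft] using H [] hn
        · trivial
      · simpa [graft] using H _ hα
      · simpa [graft] using H _ hα
      · simpa [graft] using H _ hα
    · rintro ⟨H, H0, H1, H2⟩ α hα
      rcases List.eq_nil_or_concat α with rfl | ⟨β, i, rfl⟩
      · simpa [graft, hα] using H
      · rw [List.concat_eq_append] at hα ⊢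
        fin_cases i
        · simpa [graft] using H0 β hα
        · simpa [graft] using H1 β hα
        · simpa [graft] using H2 β hα
  rw [hset, Measure.prod_prod, Measure.prod_prod, Measure.prod_prod,
    Measure.infinitePi_pi _ fun i _ => ht _, Measure.infinitePi_pi _ fun i _ => ht _,
    Measure.infinitePi_pi _ fun i _ => ht _, prod_label s]
  congr 1
  split_ifs with hn
  · rfl
  · simp

/-- Splitting is a left inverse of `graft`, so it carries the law produced by `graft` back to the
product law; this gives the independence of the root and the three subtrees. -/
theorem measurePreserving_split (S : QuadSystem d r) :
    MeasurePreserving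
      (fun ω : Noise d => (ω [], shiftNoise 0 ω, shiftNoise 1 ω, shiftNoise 2 ω)) (noiseLaw S)
      ((markLaw S).prod ((noiseLaw S).prod ((noiseLaw S).prod (noiseLaw S)))) := by
  have hm : Measurable
      (fun ω : Noise d => (ω [], shiftNoise 0 ω, shiftNoise 1 ω, shiftNoise 2 ω)) :=
    (measurable_pi_apply _).prodMk ((measurable_shiftNoise 0).prodMk
      ((measurable_shiftNoise 1).prodMk (measurable_shiftNoise 2)))
  refine ⟨hm, ?_⟩
  have hcomp : (fun ω : Noise d => (ω [], shiftNoise 0 ω, shiftNoise 1 ω, shiftNoise 2 ω)) ∘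
      graft = id := by
    funext x
    refine Prod.ext ?_ (Prod.ext ?_ (Prod.ext ?_ ?_))
    · simp [graft]
    all_goals
      funext α
      simp [graft, shiftNoise]
  conv_lhs => rw [noiseLaw, ← map_graft (markLaw S), Measure.map_map hm measurable_graft, hcomp,
    Measure.map_id]
  rfl

/-- Everything the tree rooted at `k` uses apart from the clock of the root: the uniform variable
and the offspring positions of the root, and the noises of the three potential subtrees. -/
abbrev Rest (d : ℕ) := unitInterval × (Site d × Site d) × Noise d × Noise d × Noise d

/-- The law of the offspring positions as a measure. -/
abbrev offLaw (S : QuadSystem d r) (k : Site d) : Measure (Site d × Site d) :=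
  (offspringLaw S k).toMeasure

/-- The law of `Rest` for a root at `k`. -/
def restLaw (S : QuadSystem d r) (k : Site d) : Measure (Rest d) :=
  (volume : Measure unitInterval).prod ((offLaw S k).prod
    ((noiseLaw S).prod ((noiseLaw S).prod (noiseLaw S))))

instance (S : QuadSystem d r) (k : Site d) : IsProbabilityMeasure (restLaw S k) := by
  unfold restLaw; infer_instance

/-- The non-clock part of the noise, seen from a root at `k`. -/
def rest (k : Site d) (ω : Noise d) : Rest d :=
  ((ω []).2.1, (ω []).2.2 k, shiftNoise 0 ω, shiftNoise 1 ω, shiftNoise 2 ω)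

/-- The root sits at the deterministic site `k`, so only coordinate `k` of its offspring family is
kept. The subtree noises are independent of the offspring pair, which therefore enters the subtrees
only as a choice of starting sites. -/
theorem measurePreserving_root (S : QuadSystem d r) (k : Site d) :
    MeasurePreserving (fun ω : Noise d => ((ω []).1, rest k ω)) (noiseLaw S)
      ((ProbabilityTheory.expMeasure 1).prod (restLaw S k)) := by
  have h1 : MeasurePreserving (fun m : Mark d => (m.1, m.2.1, m.2.2 k)) (markLaw S)
      ((ProbabilityTheory.expMeasure 1).prod
        ((volume : Measure unitInterval).prod (offLaw S k))) :=
    (MeasurePreserving.id _).prod ((MeasurePreserving.id _).prod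
      (measurePreserving_eval_infinitePi (fun k => offLaw S k) k))
  have h2 := (h1.prod (MeasurePreserving.id
    ((noiseLaw S).prod ((noiseLaw S).prod (noiseLaw S))))).comp (measurePreserving_split S)
  have h3 := ((MeasurePreserving.id (ProbabilityTheory.expMeasure 1)).prod
    (measurePreserving_prodAssoc (volume : Measure unitInterval) (offLaw S k)
      ((noiseLaw S).prod ((noiseLaw S).prod (noiseLaw S))))).comp
    ((measurePreserving_prodAssoc (ProbabilityTheory.expMeasure 1)
      ((volume : Measure unitInterval).prod (offLaw S k))
      ((noiseLaw S).prod ((noiseLaw S).prod (noiseLaw S)))).comp h2)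
  exact h3

/-! ### The tree identities -/

/-- The branching property holds pathwise. Recursions on labels peel off the newest letter, so an
induction on `α` leaves the first step `i` untouched. -/
theorem fullPos_append (k : Site d) (ω : Noise d) (i : Fin 3) (α : Label) :
    fullPos k ω (α ++ [i]) = fullPos (fullPos k ω [i]) (shiftNoise i ω) α := by
  induction α with
  | nil => rfl
  | cons j α ih => simp only [List.cons_append, fullPos, ih, shiftNoise]

theorem deathTime_append (S : QuadSystem d r) (k : Site d) (ω : Noise d) (i : Fin 3)
    (α : Label) : deathTime S k ω (α ++ [i]) =
      deathTime S k ω [] + deathTime S (fullPos k ω [i]) (shiftNoise i ω) α := by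
  induction α with
  | nil => rfl
  | cons j α ih =>
    have := fullPos_append k ω i (j :: α)
    rw [List.cons_append] at this
    change deathTime S k ω (α ++ [i]) +
      (S.rate (fullPos k ω (j :: (α ++ [i]))))⁻¹ * (ω (j :: (α ++ [i]))).1 = _
    rw [ih, this, add_assoc]
    rfl

theorem birthTime_append (S : QuadSystem d r) (k : Site d) (ω : Noise d) (i : Fin 3)
    (α : Label) : birthTime S k ω (α ++ [i]) =
      deathTime S k ω [] + birthTime S (fullPos k ω [i]) (shiftNoise i ω) α := by
  cases α with
  | nil => exact (add_zero _).symm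
  | cons j α => exact deathTime_append S k ω i α

theorem isPresent_append (S : QuadSystem d r) (k : Site d) (ω : Noise d) (i : Fin 3)
    (α : Label) : IsPresent S k ω (α ++ [i]) ↔
      IsPresent S k ω [i] ∧ IsPresent S (fullPos k ω [i]) (shiftNoise i ω) α := by
  induction α with
  | nil => simp [IsPresent]
  | cons j α ih =>
    simp only [List.cons_append, IsPresent, ih, fullPos_append, shiftNoise, and_assoc]

/-- Existence of the child is essential: otherwise the shifted tree lies entirely in the cemetery,
while a branching tree always has a root. -/
theorem shift_branchingTree (S : QuadSystem d r) (k : Site d) (ω : Noise d) (i : Fin 3)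
    (h : IsPresent S k ω [i]) : shift i (branchingTree S k ω) =
      branchingTree S (fullPos k ω [i]) (shiftNoise i ω) := by
  funext α
  have hp := isPresent_append S k ω i α
  simp only [h, true_and] at hp
  simp only [shift, branchingTree, pos, birth, death, fullPos_append, birthTime_append,
    deathTime_append, add_sub_cancel_left]
  by_cases hq : IsPresent S (fullPos k ω [i]) (shiftNoise i ω) α
  · rw [if_pos hq, if_pos (hp.2 hq)]
  · rw [if_neg hq, if_neg (mt hp.1 hq)]

/-! ### The exponential clock -/

open ProbabilityTheory in
theorem expMeasure_eq_withDensity :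
    expMeasure 1 = volume.withDensity (exponentialPDF 1) := rfl

open ProbabilityTheory in
theorem measurable_exponentialPDF (c : ℝ) : Measurable (exponentialPDF c) :=
  (measurable_exponentialPDFReal c).ennreal_ofReal

theorem expMeasure_ac : ProbabilityTheory.expMeasure 1 ≪ (volume : Measure ℝ) := by
  rw [expMeasure_eq_withDensity]
  exact withDensity_absolutelyContinuous _ _

theorem ae_expMeasure_nonneg : ∀ᵐ x ∂(ProbabilityTheory.expMeasure 1), 0 ≤ x := by
  rw [expMeasure_eq_withDensity, ae_withDensity_iff (measurable_exponentialPDF 1)]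
  refine Eventually.of_forall fun x hx => ?_
  by_contra h
  exact hx (ProbabilityTheory.exponentialPDF_of_neg (not_le.1 h))

-- Tilting the mean-one exponential density by `e^{-cx}` gives `1 / (1 + c)` times the exponential
-- density of rate `1 + c`, which has mass one.
open ProbabilityTheory in
theorem lintegral_expMeasure_exp {c : ℝ} (hc : 0 ≤ c) :
    ∫⁻ x, ENNReal.ofReal (Real.exp (-(c * x))) ∂(expMeasure 1) = ENNReal.ofReal (1 / (1 + c)) := by
  rw [expMeasure_eq_withDensity, lintegral_withDensity_eq_lintegral_mul _
    (measurable_exponentialPDF 1) (by fun_prop)]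
  have h : (exponentialPDF 1 * fun x => ENNReal.ofReal (Real.exp (-(c * x)))) =
      fun x => ENNReal.ofReal (1 / (1 + c)) * exponentialPDF (1 + c) x := by
    funext x
    simp only [Pi.mul_apply, exponentialPDF_eq]
    rw [← ENNReal.ofReal_mul' (Real.exp_nonneg _), ← ENNReal.ofReal_mul (by positivity)]
    congr 1
    split_ifs
    · rw [one_mul, one_mul, ← Real.exp_add, ← mul_assoc, one_div,
        inv_mul_cancel₀ (by positivity), one_mul]
      congr 1
      ring
    · simp
  rw [h, lintegral_const_mul _ (measurable_exponentialPDF _),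
    lintegral_exponentialPDF_eq_one (by positivity), mul_one]

theorem one_div_one_add_div {lam β : ℝ} (hl : 0 < lam) (hβ : 0 ≤ β) :
    1 / (1 + β / lam) = lam / (lam + β) := by
  have : 0 < lam + β := by positivity
  field_simp

open Classical in
/-- One renewal step, as a bound. -/
theorem lintegral_renewal_le {Z : Type*} [MeasurableSpace Z] (ν : Measure Z) [SFinite ν]
    {f : ℝ → Z → ℝ≥0∞} (hf : Measurable (Function.uncurry f)) {lam t b β : ℝ} (hl : 0 < lam)
    (hb : 0 ≤ b) (hβ : 0 ≤ β)
    (h : ∀ s, 0 ≤ s → s ≤ t → ∫⁻ z, f s z ∂ν ≤ ENNReal.ofReal (b * Real.exp (β * s))) :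
    ∫⁻ x, (if 0 ≤ x.1 ∧ x.1 ≤ lam * t then f (t - lam⁻¹ * x.1) x.2 else 0)
      ∂((ProbabilityTheory.expMeasure 1).prod ν) ≤
        ENNReal.ofReal (b * (lam / (lam + β)) * Real.exp (β * t)) := by
  have hm : MeasurableSet {x : ℝ × Z | 0 ≤ x.1 ∧ x.1 ≤ lam * t} :=
    (measurableSet_le measurable_const measurable_fst).inter
      (measurableSet_le measurable_fst measurable_const)
  have hF : Measurable fun x : ℝ × Z => if 0 ≤ x.1 ∧ x.1 ≤ lam * t then
      f (t - lam⁻¹ * x.1) x.2 else 0 := by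
    refine Measurable.ite hm ?_ measurable_const
    exact hf.comp ((measurable_const.sub (measurable_fst.const_mul _)).prodMk measurable_snd)
  rw [lintegral_prod _ hF.aemeasurable]
  -- The weight at the remaining time factors as `e^{β(t - x/λ)} = e^{βt} e^{-(β/λ)x}`; the Laplace
  -- transform of the clock at `β/λ` is the gain `λ/(λ+β)`.
  calc _ ≤ ∫⁻ x, ENNReal.ofReal (b * Real.exp (β * t)) *
        ENNReal.ofReal (Real.exp (-(β / lam * x))) ∂(ProbabilityTheory.expMeasure 1) := by
        refine lintegral_mono fun x => ?_
        by_cases hx : 0 ≤ x ∧ x ≤ lam * t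
        · simp only [hx, and_self, if_true]
          have h1 : lam⁻¹ * x ≤ t := by
            rw [inv_mul_le_iff₀ hl]; exact hx.2
          refine (h _ (by linarith) ?_).trans ?_
          · have : 0 ≤ lam⁻¹ * x := mul_nonneg (inv_nonneg.2 hl.le) hx.1
            linarith
          · rw [← ENNReal.ofReal_mul' (Real.exp_nonneg _), mul_assoc b, ← Real.exp_add]
            apply le_of_eq
            congr 3
            field_simp
            ring
        · simp only [hx, if_false, lintegral_zero, zero_le]
    _ = _ := by
        rw [lintegral_const_mul _ (by fun_prop), lintegral_expMeasure_exp (by positivity),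
          ← ENNReal.ofReal_mul (by positivity), one_div_one_add_div hl hβ]
        congr 1
        ring

theorem integral_expMeasure {E : Type*} [NormedAddCommGroup E] [NormedSpace ℝ E] (g : ℝ → E) :
    ∫ x, g x ∂(ProbabilityTheory.expMeasure 1) = ∫ x in Ici (0 : ℝ), Real.exp (-x) • g x := by
  rw [expMeasure_eq_withDensity, integral_withDensity_eq_integral_toReal_smul
    (measurable_exponentialPDF 1) (Eventually.of_forall fun x => ENNReal.ofReal_lt_top),
    ← integral_indicator measurableSet_Ici]
  congr 1
  funext x
  rw [ProbabilityTheory.exponentialPDF_eq, indicator_apply]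
  simp only [mem_Ici, one_mul]
  split_ifs
  · rw [ENNReal.toReal_ofReal (Real.exp_nonneg _)]
  · simp

/-! ### Renewal at the first ring of the clock -/

section Renewal

variable {E : Type*} [NormedAddCommGroup E]
  {Z : Type*} [MeasurableSpace Z] (ν : Measure Z) [SFinite ν]
  {G : ℝ → Z → E} {lam t M : ℝ}

open Classical in
/-- The payoff `G` collected after the first clock rings. -/
def renewal (G : ℝ → Z → E) (lam t : ℝ) (x : ℝ × Z) : E :=
  if 0 ≤ x.1 ∧ x.1 < lam * t then G (t - lam⁻¹ * x.1) x.2 else 0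

theorem stronglyMeasurable_renewal (hG : StronglyMeasurable (Function.uncurry G)) :
    StronglyMeasurable (renewal G lam t) := by
  have hm : MeasurableSet {x : ℝ × Z | 0 ≤ x.1 ∧ x.1 < lam * t} :=
    (measurableSet_le measurable_const measurable_fst).inter
      (measurableSet_lt measurable_fst measurable_const)
  refine StronglyMeasurable.ite hm ?_ stronglyMeasurable_const
  exact hG.comp_measurable
    ((measurable_const.sub (measurable_fst.const_mul _)).prodMk measurable_snd)

theorem lintegral_enorm_renewal_le (hG : StronglyMeasurable (Function.uncurry G)) (hl : 0 < lam)
    {b β : ℝ} (hb : 0 ≤ b) (hβ : 0 ≤ β)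
    (h : ∀ s, 0 ≤ s → s ≤ t → ∫⁻ z, ‖G s z‖ₑ ∂ν ≤ ENNReal.ofReal (b * Real.exp (β * s))) :
    ∫⁻ x, ‖renewal G lam t x‖ₑ ∂((ProbabilityTheory.expMeasure 1).prod ν) ≤
      ENNReal.ofReal (b * (lam / (lam + β)) * Real.exp (β * t)) := by
  refine le_trans (lintegral_mono fun x => ?_)
    (lintegral_renewal_le ν (f := fun s z => ‖G s z‖ₑ) hG.enorm hl hb hβ h)
  -- The payoff uses the open window, since a particle dying exactly at `t` counts as alive; the
  -- bound was stated on the larger closed window.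
  unfold renewal
  split_ifs with h1 h2 h2
  · rfl
  · exact absurd ⟨h1.1, h1.2.le⟩ h2
  · simp
  · simp

theorem integrable_renewal (hG : StronglyMeasurable (Function.uncurry G)) (hl : 0 < lam)
    (hM : 0 ≤ M) (h : ∀ s, 0 ≤ s → s ≤ t → ∫⁻ z, ‖G s z‖ₑ ∂ν ≤ ENNReal.ofReal M) :
    Integrable (renewal G lam t) ((ProbabilityTheory.expMeasure 1).prod ν) := by
  refine ⟨(stronglyMeasurable_renewal hG).aestronglyMeasurable, ?_⟩
  -- Finiteness needs no time weight, so `β = 0`.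
  refine (lintegral_enorm_renewal_le ν hG hl hM le_rfl fun s h0 hs => ?_).trans_lt
    ENNReal.ofReal_lt_top
  simpa using h s h0 hs

variable [NormedSpace ℝ E]

/-- The payoff averaged over everything but the clock, in real time. -/
def renewalSource (ν : Measure Z) (G : ℝ → Z → E) (lam t s : ℝ) : E :=
  (lam * Real.exp (-(lam * (t - s)))) • ∫ z, G s z ∂ν

theorem intervalIntegrable_renewalSource (hG : StronglyMeasurable (Function.uncurry G))
    (hl : 0 < lam) (ht : 0 ≤ t) (hM : 0 ≤ M)
    (h : ∀ s, 0 ≤ s → s ≤ t → ∫⁻ z, ‖G s z‖ₑ ∂ν ≤ ENNReal.ofReal M) :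
    IntervalIntegrable (renewalSource ν G lam t) volume 0 t := by
  rw [intervalIntegrable_iff_integrableOn_Ioc_of_le ht]
  refine Measure.integrableOn_of_bounded (M := lam * M) (by simp) ?_ ?_
  · refine AEStronglyMeasurable.smul (Continuous.aestronglyMeasurable (by fun_prop)) ?_
    exact (hG.integral_prod_right (ν := ν)).aestronglyMeasurable
  · filter_upwards [ae_restrict_mem measurableSet_Ioc] with s hs
    have h1 : ‖∫ z, G s z ∂ν‖ ≤ M := by
      have h2 := (enorm_integral_le_lintegral_enorm (μ := ν) (fun z => G s z)).trans
        (h s hs.1.le hs.2)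
      rwa [← ofReal_norm, ENNReal.ofReal_le_ofReal_iff hM] at h2
    rw [renewalSource, norm_smul, Real.norm_eq_abs, abs_of_nonneg (by positivity)]
    refine mul_le_mul ?_ h1 (norm_nonneg _) hl.le
    refine mul_le_of_le_one_right hl.le (Real.exp_le_one_iff.2 ?_)
    have := mul_nonneg hl.le (sub_nonneg.2 hs.2)
    linarith

/-- One renewal step, as an identity. -/
theorem integral_renewal [CompleteSpace E] (hG : StronglyMeasurable (Function.uncurry G))
    (hl : 0 < lam) (ht : 0 ≤ t) (hM : 0 ≤ M)
    (h : ∀ s, 0 ≤ s → s ≤ t → ∫⁻ z, ‖G s z‖ₑ ∂ν ≤ ENNReal.ofReal M) :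
    ∫ x, renewal G lam t x ∂((ProbabilityTheory.expMeasure 1).prod ν) =
      ∫ s in (0 : ℝ)..t, renewalSource ν G lam t s := by
  rw [integral_prod _ (integrable_renewal ν hG hl hM h), integral_expMeasure]
  -- This prepares the substitution `s = t - x/λ`, which turns `e^{-x} dx` on `[0, λt)` into `λ
  -- e^{-λ(t-s)} ds` on `(0, t]`.
  have h1 : ∀ x : ℝ, Real.exp (-x) • ∫ z, renewal G lam t (x, z) ∂ν =
      (Ico 0 (lam * t)).indicator
        (fun x => lam⁻¹ • renewalSource ν G lam t (t - x / lam)) x := by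
    intro x
    rw [indicator_apply]
    by_cases hx : 0 ≤ x ∧ x < lam * t
    · have hx' : x ∈ Ico 0 (lam * t) := hx
      simp only [renewal, hx, hx', and_self, if_true, renewalSource, smul_smul]
      rw [← mul_assoc, inv_mul_cancel₀ hl.ne', one_mul, sub_sub_cancel, mul_div_cancel₀ _ hl.ne',
        div_eq_inv_mul]
    · have hx' : x ∉ Ico 0 (lam * t) := hx
      simp [renewal, hx, hx']
  simp only [h1]
  rw [setIntegral_indicator measurableSet_Ico, inter_eq_self_of_subset_right Ico_subset_Ici_self,
    integral_Ico_eq_integral_Ioc, ← intervalIntegral.integral_of_le (by positivity),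
    intervalIntegral.integral_smul, intervalIntegral.integral_comp_sub_div _ hl.ne']
  rw [smul_smul, inv_mul_cancel₀ hl.ne', one_smul, mul_div_cancel_left₀ _ hl.ne']
  simp

end Renewal

/-! ### Elementary facts on the coefficients -/

theorem QuadSystem.qtot_nonneg (S : QuadSystem d r) (k : Site d) : 0 ≤ S.qtot k :=
  tsum_nonneg fun _ => (S.q_mem _ _ _).1

theorem QuadSystem.dth_eq (S : QuadSystem d r) (k : Site d) :
    S.dth k = 1 - S.qtot k - S.p k := by
  have := S.prob_sum k
  unfold QuadSystem.qtot
  linarith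

theorem QuadSystem.p_le (S : QuadSystem d r) (k : Site d) : S.p k ≤ 1 - S.qtot k := by
  have := S.dth_eq k
  have := (S.dth_mem k).1
  linarith

theorem QuadSystem.qtot_le_one (S : QuadSystem d r) (k : Site d) : S.qtot k ≤ 1 := by
  have := S.p_le k
  have := (S.p_mem k).1
  linarith

/-- Weighting time by `e^{βt}` makes the linear part contract, uniformly over all modes. -/
theorem QuadSystem.exists_contraction (S : QuadSystem d r) {A : ℝ} (hA : 0 ≤ A) :
    ∃ β, 0 ≤ β ∧ ∀ k, A * (S.p k + S.qtot k) * (S.rate k / (S.rate k + β)) ≤ 1 / 2 := by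
  have hlim : Tendsto (fun k => A * (S.p k + S.qtot k)) cofinite (nhds 0) := by
    simpa [QuadSystem.qtot] using (S.p_tendsto.add S.q_tendsto).const_mul A
  have hfin : {k | ¬ A * (S.p k + S.qtot k) ≤ 1 / 2}.Finite :=
    eventually_cofinite.1 ((hlim.eventually_lt_const (by norm_num : (0 : ℝ) < 1 / 2)).mono
      fun _ h => h.le)
  -- Summing over the exceptional modes gives `β ≥ 2Aλ_k` for each of them, so `Aλ_k ≤ β/2` and `p_k
  -- + q_k ≤ 1` suffices there. At the other modes the fraction is bounded by one.
  refine ⟨∑ k ∈ hfin.toFinset, 2 * A * S.rate k,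
    Finset.sum_nonneg fun k _ => mul_nonneg (by positivity) (S.rate_pos k).le, fun k => ?_⟩
  set β := ∑ k ∈ hfin.toFinset, 2 * A * S.rate k with hβ
  have hβ0 : 0 ≤ β :=
    Finset.sum_nonneg fun k _ => mul_nonneg (by positivity) (S.rate_pos k).le
  have hl := S.rate_pos k
  have hpq0 : 0 ≤ S.p k + S.qtot k := add_nonneg (S.p_mem k).1 (S.qtot_nonneg k)
  have hpq1 : S.p k + S.qtot k ≤ 1 := by have := S.p_le k; linarith
  by_cases hk : A * (S.p k + S.qtot k) ≤ 1 / 2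
  · refine (mul_le_of_le_one_right (by positivity) ?_).trans hk
    exact (div_le_one (by positivity)).2 (by linarith)
  · have h1 : 2 * A * S.rate k ≤ β :=
      Finset.single_le_sum (f := fun k => 2 * A * S.rate k)
        (fun k _ => mul_nonneg (by positivity) (S.rate_pos k).le) (hfin.mem_toFinset.2 hk)
    rw [← mul_div_assoc, div_le_iff₀ (by positivity)]
    have h2 : A * (S.p k + S.qtot k) * S.rate k ≤ A * S.rate k :=
      mul_le_mul_of_nonneg_right (mul_le_of_le_one_right hA hpq1) hl.le
    linarith

/-! ### One step of the recursion -/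

/-- The values of the uniform variable for which a particle at `k` flips. -/
def flipSet (S : QuadSystem d r) (k : Site d) : Set unitInterval := {u | (u : ℝ) ≤ S.p k}

/-- The values of the uniform variable for which a particle at `k` branches. -/
def branchSet (S : QuadSystem d r) (k : Site d) : Set unitInterval := {u | 1 - S.qtot k ≤ (u : ℝ)}

/-- The values of the uniform variable for which a particle at `k` dies. -/
def dieSet (S : QuadSystem d r) (k : Site d) : Set unitInterval :=
  {u | S.p k < (u : ℝ) ∧ (u : ℝ) < 1 - S.qtot k}

theorem measurableSet_flipSet (S : QuadSystem d r) (k : Site d) : MeasurableSet (flipSet S k) :=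
  measurableSet_le measurable_subtype_coe measurable_const

theorem measurableSet_branchSet (S : QuadSystem d r) (k : Site d) :
    MeasurableSet (branchSet S k) :=
  measurableSet_le measurable_const measurable_subtype_coe

theorem measurableSet_dieSet (S : QuadSystem d r) (k : Site d) : MeasurableSet (dieSet S k) :=
  (measurableSet_lt measurable_const measurable_subtype_coe).inter
    (measurableSet_lt measurable_subtype_coe measurable_const)

theorem QuadSystem.one_sub_qtot_mem (S : QuadSystem d r) (k : Site d) :
    1 - S.qtot k ∈ Icc (0 : ℝ) 1 :=
  ⟨sub_nonneg.2 (S.qtot_le_one k), by linarith [S.qtot_nonneg k]⟩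

theorem volume_flipSet (S : QuadSystem d r) (k : Site d) :
    volume (flipSet S k) = ENNReal.ofReal (S.p k) :=
  unitInterval.volume_Iic ⟨S.p k, S.p_mem k⟩

theorem volume_branchSet (S : QuadSystem d r) (k : Site d) :
    volume (branchSet S k) = ENNReal.ofReal (S.qtot k) := by
  have := unitInterval.volume_Ici ⟨1 - S.qtot k, S.one_sub_qtot_mem k⟩
  rw [sub_sub_cancel] at this
  exact this

theorem volume_dieSet (S : QuadSystem d r) (k : Site d) :
    volume (dieSet S k) = ENNReal.ofReal (S.dth k) := by
  rw [S.dth_eq]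
  exact unitInterval.volume_Ioo ⟨S.p k, S.p_mem k⟩ ⟨1 - S.qtot k, S.one_sub_qtot_mem k⟩

/-- As `p_k ≤ 1 - q_k`, the overlap is at most one point. At such a point all three children would
exist, a case for which the evaluation has no rule beyond its default value. -/
theorem volume_flipSet_inter_branchSet (S : QuadSystem d r) (k : Site d) :
    volume (flipSet S k ∩ branchSet S k) = 0 := by
  refine measure_mono_null (t := {⟨S.p k, S.p_mem k⟩}) ?_ (measure_singleton _)
  rintro u ⟨h1, h2⟩
  refine Subtype.ext (le_antisymm h1 ((S.p_le k).trans h2))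

/-- A flip involves only the uniform variable and the label-`0` noise. Discarding the other
coordinates reduces its contribution to an integral of a product. -/
theorem measurePreserving_restFlip (S : QuadSystem d r) (k : Site d) :
    MeasurePreserving (fun z : Rest d => (z.1, z.2.2.1)) (restLaw S k)
      ((volume : Measure unitInterval).prod (noiseLaw S)) :=
  (MeasurePreserving.id _).prod (measurePreserving_fst.comp measurePreserving_snd)

theorem measurePreserving_restBranch (S : QuadSystem d r) (k : Site d) :
    MeasurePreserving (fun z : Rest d => (z.1, z.2.1, z.2.2.2)) (restLaw S k)
      ((volume : Measure unitInterval).prod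
        ((offLaw S k).prod ((noiseLaw S).prod (noiseLaw S)))) :=
  (MeasurePreserving.id _).prod ((MeasurePreserving.id _).prod measurePreserving_snd)

/-- The indicator of a set of uniform variables. -/
abbrev uInd (I : Set unitInterval) (u : unitInterval) : ℝ := I.indicator 1 u

theorem measurable_uInd {I : Set unitInterval} (hI : MeasurableSet I) : Measurable (uInd I) :=
  measurable_one.indicator hI

theorem lintegral_uInd {I : Set unitInterval} (hI : MeasurableSet I) {w : ℝ}
    (hw : volume I = ENNReal.ofReal w) : ∫⁻ u, ‖uInd I u‖ₑ = ENNReal.ofReal w := by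
  rw [← hw, ← lintegral_indicator_one hI]
  congr 1
  funext u
  by_cases h : u ∈ I <;> simp [uInd, h]

theorem integral_uInd {I : Set unitInterval} (hI : MeasurableSet I) {w : ℝ} (hw0 : 0 ≤ w)
    (hw : volume I = ENNReal.ofReal w) : ∫ u, uInd I u = w := by
  rw [integral_indicator_one hI, Measure.real, hw, ENNReal.toReal_ofReal hw0]

theorem lintegral_uInd_mul {Z : Type*} [MeasurableSpace Z] (ν : Measure Z) [SFinite ν]
    {I : Set unitInterval} (hI : MeasurableSet I) {w : ℝ} (hw : volume I = ENNReal.ofReal w)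
    {f : Z → ℝ≥0∞} (hf : Measurable f) :
    ∫⁻ x : unitInterval × Z, ‖uInd I x.1‖ₑ * f x.2 ∂((volume : Measure unitInterval).prod ν) =
      ENNReal.ofReal w * ∫⁻ z, f z ∂ν := by
  rw [lintegral_prod_mul (measurable_uInd hI).enorm.aemeasurable hf.aemeasurable,
    lintegral_uInd hI hw]

/-! #### The bilinear operators as continuous maps -/

/-- `B_{k,l,m}` as a continuous bilinear map. -/
def Bc (S : QuadSystem d r) (k l m : Site d) : Val r →L[ℂ] Val r →L[ℂ] Val r :=
  LinearMap.mkContinuous₂ (S.B k l m) 1 fun x y => by simpa using S.norm_B_le k l m x y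

theorem measurable_B (S : QuadSystem d r) (k l m : Site d) {W : Type*} [MeasurableSpace W]
    {f g : W → Val r} (hf : Measurable f) (hg : Measurable g) :
    Measurable fun w => S.B k l m (f w) (g w) :=
  (Bc S k l m).continuous₂.measurable.comp (hf.prodMk hg)

theorem enorm_B_le (S : QuadSystem d r) (k l m : Site d) (x y : Val r) :
    ‖S.B k l m x y‖ₑ ≤ ‖x‖ₑ * ‖y‖ₑ := by
  rw [← ofReal_norm, ← ofReal_norm, ← ofReal_norm, ← ENNReal.ofReal_mul (norm_nonneg _)]
  exact ENNReal.ofReal_le_ofReal (S.norm_B_le k l m x y)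

/-- Independence lets a bilinear map commute with expectation under first moments alone: the
integral passes through one slot at a time as a continuous linear map. -/
theorem integral_B (S : QuadSystem d r) (k l m : Site d) {W W' : Type*} [MeasurableSpace W]
    [MeasurableSpace W'] {μ : Measure W} {ν : Measure W'} [SFinite μ] [SFinite ν]
    {f : W → Val r} {g : W' → Val r} (hf : Integrable f μ) (hg : Integrable g ν) :
    Integrable (fun w : W × W' => S.B k l m (f w.1) (g w.2)) (μ.prod ν) ∧
    ∫ w, S.B k l m (f w.1) (g w.2) ∂(μ.prod ν) = S.B k l m (∫ w, f w ∂μ) (∫ w, g w ∂ν) := by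
  have hi : Integrable (fun w : W × W' => S.B k l m (f w.1) (g w.2)) (μ.prod ν) := by
    refine Integrable.mono' (hf.norm.mul_prod hg.norm) ?_
      (Eventually.of_forall fun w => S.norm_B_le _ _ _ _ _)
    exact (Bc S k l m).aestronglyMeasurable_comp₂ hf.aestronglyMeasurable.comp_fst
      hg.aestronglyMeasurable.comp_snd
  refine ⟨hi, ?_⟩
  rw [integral_prod _ hi]
  have h1 (x : W) : ∫ y, S.B k l m (f x) (g y) ∂ν = (Bc S k l m).flip (∫ y, g y ∂ν) (f x) :=
    (Bc S k l m (f x)).integral_comp_comm hg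
  simp only [h1]
  exact ((Bc S k l m).flip (∫ y, g y ∂ν)).integral_comp_comm hf

/-- Sites are countable, so substituting a random site into a family of measurable functions
preserves measurability. -/
theorem measurable_countable_param {W C E : Type*} [MeasurableSpace W] [MeasurableSpace C]
    [Countable C] [MeasurableSingletonClass C] [MeasurableSpace E] {H : C → W → E}
    (hH : ∀ c, Measurable (H c)) {c : W → C} (hc : Measurable c) :
    Measurable fun w => H (c w) w :=
  (measurable_from_prod_countable_left (f := fun x : W × C => H x.2 x.1) hH).comp
    (measurable_id.prodMk hc)

theorem measurable_slice {W E : Type*} [MeasurableSpace W] [MeasurableSpace E] {f : ℝ → W → E}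
    (hf : Measurable (Function.uncurry f)) (s : ℝ) : Measurable (f s) :=
  hf.comp measurable_prodMk_left

/-! #### The law of the offspring -/

/-- If `q_k = 0`, every `q_{k,l,m}` vanishes as well, so the arbitrary offspring law chosen in that
case is harmless. -/
theorem qtot_mul_offspringLaw (S : QuadSystem d r) (k : Site d) (lm : Site d × Site d) :
    S.qtot k * (offspringLaw S k lm).toReal = S.q k lm.1 lm.2 := by
  have hs : (∑' lm : Site d × Site d, ENNReal.ofReal (S.q k lm.1 lm.2)) =
      ENNReal.ofReal (S.qtot k) :=
    (ENNReal.ofReal_tsum_of_nonneg (fun _ => (S.q_mem _ _ _).1) (S.q_summable k)).symm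
  by_cases h0 : S.qtot k = 0
  · have h1 : S.q k lm.1 lm.2 ≤ 0 := by
      rw [← h0]
      exact (S.q_summable k).le_tsum lm fun _ _ => (S.q_mem _ _ _).1
    rw [h0, zero_mul, le_antisymm h1 (S.q_mem _ _ _).1]
  · have hpos : 0 < S.qtot k := lt_of_le_of_ne (S.qtot_nonneg k) (Ne.symm h0)
    have hc : (∑' lm : Site d × Site d, ENNReal.ofReal (S.q k lm.1 lm.2)) ≠ 0 ∧
        (∑' lm : Site d × Site d, ENNReal.ofReal (S.q k lm.1 lm.2)) ≠ ∞ := by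
      rw [hs]
      exact ⟨(ENNReal.ofReal_pos.2 hpos).ne', ENNReal.ofReal_ne_top⟩
    rw [offspringLaw, dif_pos hc, PMF.normalize_apply, hs, ENNReal.toReal_mul, ENNReal.toReal_inv,
      ENNReal.toReal_ofReal hpos.le, ENNReal.toReal_ofReal (S.q_mem _ _ _).1]
    field_simp

/-! #### The step map -/

/-- What is collected when the clock of a particle at `k` rings with time `s` to go, if the
values of the subtrees are given by `X` (labels `0` and `1`) and `Y` (label `2`). -/
def stepVal (S : QuadSystem d r) (γ : Site d → ℝ → Val r) (X Y : Site d → ℝ → Noise d → Val r)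
    (k : Site d) (s : ℝ) (z : Rest d) : Val r :=
  uInd (dieSet S k) z.1 • γ k s + (uInd (flipSet S k) z.1 • S.Cf • X k s z.2.2.1
    + uInd (branchSet S k) z.1 • S.Cb •
      S.B k z.2.1.1 z.2.1.2 (X z.2.1.1 s z.2.2.2.1) (Y z.2.1.2 s z.2.2.2.2))

section Step

variable (S : QuadSystem d r) {γ : Site d → ℝ → Val r} {X Y : Site d → ℝ → Noise d → Val r}

theorem measurable_branchPayoff (k : Site d) (hX : ∀ l, Measurable (Function.uncurry (X l)))
    (hY : ∀ m, Measurable (Function.uncurry (Y m))) :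
    Measurable fun x : ℝ × (Site d × Site d) × Noise d × Noise d =>
      S.B k x.2.1.1 x.2.1.2 (X x.2.1.1 x.1 x.2.2.1) (Y x.2.1.2 x.1 x.2.2.2) := by
  refine measurable_countable_param (C := Site d × Site d) 
    (c := fun x : ℝ × (Site d × Site d) × Noise d × Noise d => x.2.1)
    (H := fun c x => S.B k c.1 c.2 (X c.1 x.1 x.2.2.1) (Y c.2 x.1 x.2.2.2)) (fun c => ?_)
    (by fun_prop)
  refine measurable_B S k c.1 c.2 ?_ ?_
  · exact (hX c.1).comp (f := fun x : ℝ × (Site d × Site d) × Noise d × Noise d =>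
      (x.1, x.2.2.1)) (by fun_prop)
  · exact (hY c.2).comp (f := fun x : ℝ × (Site d × Site d) × Noise d × Noise d =>
      (x.1, x.2.2.2)) (by fun_prop)

theorem measurable_stepVal (hγ : ∀ k, Measurable (γ k))
    (hX : ∀ l, Measurable (Function.uncurry (X l)))
    (hY : ∀ m, Measurable (Function.uncurry (Y m))) (k : Site d) :
    Measurable (Function.uncurry (stepVal S γ X Y k)) := by
  have hu {I : Set unitInterval} (hI : MeasurableSet I) :
      Measurable fun x : ℝ × Rest d => uInd I x.2.1 :=
    (measurable_uInd hI).comp (by fun_prop)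
  refine ((hu (measurableSet_dieSet S k)).smul ((hγ k).comp measurable_fst)).add
    (((hu (measurableSet_flipSet S k)).smul (Measurable.const_smul ?_ S.Cf)).add
      ((hu (measurableSet_branchSet S k)).smul (Measurable.const_smul ?_ S.Cb)))
  · exact (hX k).comp (f := fun x : ℝ × Rest d => (x.1, x.2.2.2.1)) (by fun_prop)
  · exact (measurable_branchPayoff S k hX hY).comp
      (f := fun x : ℝ × Rest d => (x.1, x.2.2.1, x.2.2.2.2)) (by fun_prop)

theorem measurable_branchPayoff_slice (k : Site d)
    (hX : ∀ l, Measurable (Function.uncurry (X l)))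
    (hY : ∀ m, Measurable (Function.uncurry (Y m))) (s : ℝ) :
    Measurable fun z : (Site d × Site d) × Noise d × Noise d =>
      S.B k z.1.1 z.1.2 (X z.1.1 s z.2.1) (Y z.1.2 s z.2.2) :=
  (measurable_branchPayoff S k hX hY).comp (measurable_prodMk_left (x := s))

variable {s a b c : ℝ}

/-- Given the offspring sites, the two subtrees are independent, so the first moment of the product
of norms is the product of first moments. -/
theorem lintegral_branchPayoff_le (k : Site d) (hX : ∀ l, Measurable (Function.uncurry (X l)))
    (hY : ∀ m, Measurable (Function.uncurry (Y m))) (ha : 0 ≤ a)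
    (hXa : ∀ l, ∫⁻ ω, ‖X l s ω‖ₑ ∂(noiseLaw S) ≤ ENNReal.ofReal a)
    (hYb : ∀ m, ∫⁻ ω, ‖Y m s ω‖ₑ ∂(noiseLaw S) ≤ ENNReal.ofReal b) :
    ∫⁻ z, ‖S.B k z.1.1 z.1.2 (X z.1.1 s z.2.1) (Y z.1.2 s z.2.2)‖ₑ
      ∂((offLaw S k).prod ((noiseLaw S).prod (noiseLaw S))) ≤ ENNReal.ofReal (a * b) := by
  rw [lintegral_prod]
  · calc _ ≤ ∫⁻ _, ENNReal.ofReal (a * b) ∂(offLaw S k) := by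
          refine lintegral_mono fun lm => ?_
          refine (lintegral_mono fun w => enorm_B_le S k lm.1 lm.2 _ _).trans ?_
          rw [ENNReal.ofReal_mul ha]
          refine (lintegral_prod_mul (f := fun ω => ‖X lm.1 s ω‖ₑ) (g := fun ω => ‖Y lm.2 s ω‖ₑ)
            (measurable_slice (hX _) s).enorm.aemeasurable
            (measurable_slice (hY _) s).enorm.aemeasurable).trans_le ?_
          exact mul_le_mul' (hXa _) (hYb _)
      _ = _ := by simp
  · exact (measurable_branchPayoff_slice S k hX hY s).enorm.aemeasurable

/-- The bound is affine in `a`, the moment of the unpruned subtrees, once the bound `b` for the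
pruned one is known. Its slope has the form `A (p_k + q_k)` that the contraction handles. -/
theorem lintegral_stepVal_le (hX : ∀ l, Measurable (Function.uncurry (X l)))
    (hY : ∀ m, Measurable (Function.uncurry (Y m))) (k : Site d) (ha : 0 ≤ a) (hb : 0 ≤ b)
    (hγc : ‖γ k s‖ ≤ c)
    (hXa : ∀ l, ∫⁻ ω, ‖X l s ω‖ₑ ∂(noiseLaw S) ≤ ENNReal.ofReal a)
    (hYb : ∀ m, ∫⁻ ω, ‖Y m s ω‖ₑ ∂(noiseLaw S) ≤ ENNReal.ofReal b) :
    ∫⁻ z, ‖stepVal S γ X Y k s z‖ₑ ∂(restLaw S k) ≤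
      ENNReal.ofReal (c + (S.Cf + S.Cb * b) * (S.p k + S.qtot k) * a) := by
  have hc : 0 ≤ c := (norm_nonneg _).trans hγc
  have hp := (S.p_mem k).1
  have hq := S.qtot_nonneg k
  have hCf := S.Cf_nonneg
  have hCb := S.Cb_nonneg
  have hXm : Measurable fun ω => ‖S.Cf • X k s ω‖ₑ :=
    ((measurable_slice (hX k) s).const_smul S.Cf).enorm
  have hBm : Measurable fun z : (Site d × Site d) × Noise d × Noise d =>
      ‖S.Cb • S.B k z.1.1 z.1.2 (X z.1.1 s z.2.1) (Y z.1.2 s z.2.2)‖ₑ :=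
    ((measurable_branchPayoff_slice S k hX hY s).const_smul S.Cb).enorm
  have hdie : ∫⁻ z : Rest d, ‖uInd (dieSet S k) z.1‖ₑ * ‖γ k s‖ₑ ∂(restLaw S k) ≤
      ENNReal.ofReal c := by
    have h0 : Measurable fun z : Rest d => ‖uInd (dieSet S k) z.1‖ₑ :=
      (measurable_uInd (measurableSet_dieSet S k)).enorm.comp measurable_fst
    rw [lintegral_mul_const _ h0]
    have h1 : ∫⁻ z : Rest d, ‖uInd (dieSet S k) z.1‖ₑ ∂(restLaw S k) =
        ∫⁻ u, ‖uInd (dieSet S k) u‖ₑ := by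
      have hmp : MeasurePreserving (Prod.fst : Rest d → unitInterval) (restLaw S k) volume :=
        measurePreserving_fst
      exact hmp.lintegral_comp (measurable_uInd (measurableSet_dieSet S k)).enorm
    rw [h1, lintegral_uInd (measurableSet_dieSet S k) (volume_dieSet S k), ← ofReal_norm,
      ← ENNReal.ofReal_mul (S.dth_mem k).1]
    exact ENNReal.ofReal_le_ofReal
      ((mul_le_of_le_one_left (norm_nonneg _) (S.dth_mem k).2).trans hγc)
  have hflip : ∫⁻ z : Rest d, ‖uInd (flipSet S k) z.1‖ₑ * ‖S.Cf • X k s z.2.2.1‖ₑ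
      ∂(restLaw S k) ≤ ENNReal.ofReal (S.p k * (S.Cf * a)) := by
    have h1 := (measurePreserving_restFlip S k).lintegral_comp
      (f := fun x => ‖uInd (flipSet S k) x.1‖ₑ * ‖S.Cf • X k s x.2‖ₑ)
      (((measurable_uInd (measurableSet_flipSet S k)).enorm.comp measurable_fst).mul
        (hXm.comp measurable_snd))
    rw [h1, lintegral_uInd_mul _ (measurableSet_flipSet S k) (volume_flipSet S k) hXm,
      ENNReal.ofReal_mul hp]
    gcongr
    simp only [enorm_smul]
    rw [lintegral_const_mul _ (measurable_slice (hX k) s).enorm, ENNReal.ofReal_mul hCf,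
      Real.enorm_of_nonneg hCf]
    gcongr
    exact hXa k
  have hbranch : ∫⁻ z : Rest d, ‖uInd (branchSet S k) z.1‖ₑ *
      ‖S.Cb • S.B k z.2.1.1 z.2.1.2 (X z.2.1.1 s z.2.2.2.1) (Y z.2.1.2 s z.2.2.2.2)‖ₑ
      ∂(restLaw S k) ≤ ENNReal.ofReal (S.qtot k * (S.Cb * (a * b))) := by
    have h1 := (measurePreserving_restBranch S k).lintegral_comp
      (f := fun x => ‖uInd (branchSet S k) x.1‖ₑ *
        ‖S.Cb • S.B k x.2.1.1 x.2.1.2 (X x.2.1.1 s x.2.2.1) (Y x.2.1.2 s x.2.2.2)‖ₑ)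
      (((measurable_uInd (measurableSet_branchSet S k)).enorm.comp measurable_fst).mul
        (hBm.comp measurable_snd))
    rw [h1, lintegral_uInd_mul _ (measurableSet_branchSet S k) (volume_branchSet S k) hBm,
      ENNReal.ofReal_mul hq]
    gcongr
    simp only [enorm_smul]
    rw [lintegral_const_mul _ (measurable_branchPayoff_slice S k hX hY s).enorm, ENNReal.ofReal_mul hCb, Real.enorm_of_nonneg hCb]
    gcongr
    exact lintegral_branchPayoff_le S k hX hY ha hXa hYb
  have hm1 : Measurable fun z : Rest d => ‖uInd (dieSet S k) z.1‖ₑ * ‖γ k s‖ₑ :=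
    ((measurable_uInd (measurableSet_dieSet S k)).enorm.comp measurable_fst).mul_const _
  have hm2 : Measurable fun z : Rest d =>
      ‖uInd (flipSet S k) z.1‖ₑ * ‖S.Cf • X k s z.2.2.1‖ₑ :=
    ((measurable_uInd (measurableSet_flipSet S k)).enorm.comp measurable_fst).mul
      (hXm.comp (by fun_prop))
  calc _ ≤ ∫⁻ z : Rest d, (‖uInd (dieSet S k) z.1‖ₑ * ‖γ k s‖ₑ +
        (‖uInd (flipSet S k) z.1‖ₑ * ‖S.Cf • X k s z.2.2.1‖ₑ + ‖uInd (branchSet S k) z.1‖ₑ *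
          ‖S.Cb • S.B k z.2.1.1 z.2.1.2 (X z.2.1.1 s z.2.2.2.1) (Y z.2.1.2 s z.2.2.2.2)‖ₑ))
          ∂(restLaw S k) := by
        refine lintegral_mono fun z => ?_
        rw [← enorm_smul, ← enorm_smul, ← enorm_smul]
        exact (enorm_add_le _ _).trans (add_le_add le_rfl (enorm_add_le _ _))
    _ ≤ ENNReal.ofReal c + (ENNReal.ofReal (S.p k * (S.Cf * a)) +
        ENNReal.ofReal (S.qtot k * (S.Cb * (a * b)))) := by
        rw [lintegral_add_left hm1, lintegral_add_left hm2]
        exact add_le_add hdie (add_le_add hflip hbranch)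
    _ ≤ _ := by
        rw [← ENNReal.ofReal_add (by positivity) (by positivity),
          ← ENNReal.ofReal_add hc (by positivity)]
        refine ENNReal.ofReal_le_ofReal ?_
        -- The exact slope is `C_f p + C_b b q`; adding these two cross terms makes it factor.
        have h1 : 0 ≤ S.Cf * S.qtot k * a := by positivity
        have h2 : 0 ≤ S.Cb * b * S.p k * a := by positivity
        nlinarith

/-- Integrating over the offspring first yields a series with weights `q_{k,l,m} / q_k`; the
branching probability `q_k` cancels the normalization. -/
theorem integral_branchPayoff (k : Site d) (hX : ∀ l, Measurable (Function.uncurry (X l)))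
    (hY : ∀ m, Measurable (Function.uncurry (Y m))) (ha : 0 ≤ a)
    (hXa : ∀ l, ∫⁻ ω, ‖X l s ω‖ₑ ∂(noiseLaw S) ≤ ENNReal.ofReal a)
    (hYb : ∀ m, ∫⁻ ω, ‖Y m s ω‖ₑ ∂(noiseLaw S) ≤ ENNReal.ofReal b) :
    Integrable (fun z : (Site d × Site d) × Noise d × Noise d =>
      S.B k z.1.1 z.1.2 (X z.1.1 s z.2.1) (Y z.1.2 s z.2.2))
      ((offLaw S k).prod ((noiseLaw S).prod (noiseLaw S))) ∧
    S.qtot k • ∫ z, S.B k z.1.1 z.1.2 (X z.1.1 s z.2.1) (Y z.1.2 s z.2.2)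
      ∂((offLaw S k).prod ((noiseLaw S).prod (noiseLaw S))) =
    ∑' lm : Site d × Site d, quadTerm S k (fun l => ∫ ω, X l s ω ∂(noiseLaw S))
      (fun m => ∫ ω, Y m s ω ∂(noiseLaw S)) lm := by
  have hi : Integrable (fun z : (Site d × Site d) × Noise d × Noise d =>
      S.B k z.1.1 z.1.2 (X z.1.1 s z.2.1) (Y z.1.2 s z.2.2))
      ((offLaw S k).prod ((noiseLaw S).prod (noiseLaw S))) := by
    refine ⟨(measurable_branchPayoff_slice S k hX hY s).aestronglyMeasurable, ?_⟩
    exact (lintegral_branchPayoff_le S k hX hY ha hXa hYb).trans_lt ENNReal.ofReal_lt_top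
  have hXi (l) : Integrable (X l s) (noiseLaw S) :=
    ⟨(measurable_slice (hX l) s).aestronglyMeasurable,
      (hXa l).trans_lt ENNReal.ofReal_lt_top⟩
  have hYi (m) : Integrable (Y m s) (noiseLaw S) :=
    ⟨(measurable_slice (hY m) s).aestronglyMeasurable,
      (hYb m).trans_lt ENNReal.ofReal_lt_top⟩
  refine ⟨hi, ?_⟩
  rw [integral_prod _ hi, PMF.integral_eq_tsum _ _ hi.integral_prod_left, ← tsum_const_smul'']
  refine tsum_congr fun lm => ?_
  rw [smul_smul, qtot_mul_offspringLaw, quadTerm, ← (integral_B S k lm.1 lm.2 (hXi _) (hYi _)).2]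

/-- The averaged step is exactly the bracket of the mild equation: the uniform variable weights
death, flip and branching by `d_k`, `p_k` and `q_k`, independently of the subtrees. -/
theorem integral_stepVal (hX : ∀ l, Measurable (Function.uncurry (X l)))
    (hY : ∀ m, Measurable (Function.uncurry (Y m))) (k : Site d) (ha : 0 ≤ a)
    (hXa : ∀ l, ∫⁻ ω, ‖X l s ω‖ₑ ∂(noiseLaw S) ≤ ENNReal.ofReal a)
    (hYb : ∀ m, ∫⁻ ω, ‖Y m s ω‖ₑ ∂(noiseLaw S) ≤ ENNReal.ofReal b) :
    ∫ z, stepVal S γ X Y k s z ∂(restLaw S k) =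
      (S.Cf * S.p k) • (∫ ω, X k s ω ∂(noiseLaw S))
      + S.Cb • ∑' lm : Site d × Site d, quadTerm S k (fun l => ∫ ω, X l s ω ∂(noiseLaw S))
          (fun m => ∫ ω, Y m s ω ∂(noiseLaw S)) lm
      + S.dth k • γ k s := by
  have hind {I : Set unitInterval} (hI : MeasurableSet I) :
      Integrable (uInd I) (volume : Measure unitInterval) :=
    (integrable_const (1 : ℝ)).indicator hI
  have hXi : Integrable (fun ω => S.Cf • X k s ω) (noiseLaw S) :=
    Integrable.smul (f := X k s) S.Cf ⟨(measurable_slice (hX k) s).aestronglyMeasurable,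
      (hXa k).trans_lt ENNReal.ofReal_lt_top⟩
  obtain ⟨hBi, hBq⟩ := integral_branchPayoff S k hX hY ha hXa hYb
  have hBi' := hBi.smul S.Cb
  have i1 : Integrable (fun z : Rest d => uInd (dieSet S k) z.1 • γ k s) (restLaw S k) :=
    ((hind (measurableSet_dieSet S k)).comp_fst _).smul_const _
  have i2 : Integrable (fun z : Rest d => uInd (flipSet S k) z.1 • S.Cf • X k s z.2.2.1)
      (restLaw S k) :=
    (measurePreserving_restFlip S k).integrable_comp_of_integrable
      ((hind (measurableSet_flipSet S k)).smul_prod hXi)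
  have i3 : Integrable (fun z : Rest d => uInd (branchSet S k) z.1 • S.Cb •
      S.B k z.2.1.1 z.2.1.2 (X z.2.1.1 s z.2.2.2.1) (Y z.2.1.2 s z.2.2.2.2)) (restLaw S k) :=
    (measurePreserving_restBranch S k).integrable_comp_of_integrable
      ((hind (measurableSet_branchSet S k)).smul_prod hBi')
  have e1 : ∫ z : Rest d, uInd (dieSet S k) z.1 • γ k s ∂(restLaw S k) = S.dth k • γ k s := by
    rw [integral_smul_const]
    congr 1
    rw [restLaw, integral_fun_fst]
    rw [integral_uInd (measurableSet_dieSet S k) (S.dth_mem k).1 (volume_dieSet S k)]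
    simp
  have e2 : ∫ z : Rest d, uInd (flipSet S k) z.1 • S.Cf • X k s z.2.2.1 ∂(restLaw S k) =
      (S.Cf * S.p k) • ∫ ω, X k s ω ∂(noiseLaw S) := by
    have := integral_map (μ := restLaw S k) (measurePreserving_restFlip S k).aemeasurable
      (f := fun x => uInd (flipSet S k) x.1 • S.Cf • X k s x.2)
      (by rw [(measurePreserving_restFlip S k).map_eq]
          exact ((hind (measurableSet_flipSet S k)).smul_prod hXi).aestronglyMeasurable)
    rw [← this, (measurePreserving_restFlip S k).map_eq,
      integral_prod_smul (uInd (flipSet S k)) (fun ω => S.Cf • X k s ω),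
      integral_uInd (measurableSet_flipSet S k) (S.p_mem k).1 (volume_flipSet S k),
      integral_smul, smul_smul, mul_comm]
  have e3 : ∫ z : Rest d, uInd (branchSet S k) z.1 • S.Cb •
      S.B k z.2.1.1 z.2.1.2 (X z.2.1.1 s z.2.2.2.1) (Y z.2.1.2 s z.2.2.2.2) ∂(restLaw S k) =
      S.Cb • ∑' lm : Site d × Site d, quadTerm S k (fun l => ∫ ω, X l s ω ∂(noiseLaw S))
          (fun m => ∫ ω, Y m s ω ∂(noiseLaw S)) lm := by
    have := integral_map (μ := restLaw S k) (measurePreserving_restBranch S k).aemeasurable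
      (f := fun x => uInd (branchSet S k) x.1 • S.Cb •
        S.B k x.2.1.1 x.2.1.2 (X x.2.1.1 s x.2.2.1) (Y x.2.1.2 s x.2.2.2))
      (by rw [(measurePreserving_restBranch S k).map_eq]
          exact ((hind (measurableSet_branchSet S k)).smul_prod hBi').aestronglyMeasurable)
    rw [← this, (measurePreserving_restBranch S k).map_eq,
      integral_prod_smul (uInd (branchSet S k))
        (fun z : (Site d × Site d) × Noise d × Noise d =>
          S.Cb • S.B k z.1.1 z.1.2 (X z.1.1 s z.2.1) (Y z.1.2 s z.2.2)),
      integral_uInd (measurableSet_branchSet S k) (S.qtot_nonneg k) (volume_branchSet S k),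
      integral_smul, smul_comm, hBq]
  unfold stepVal
  have h1 := integral_add i1 (i2.add i3)
  have h2 := integral_add i2 i3
  simp only [Pi.add_apply] at h1
  rw [h1, h2, e1, e2, e3, add_comm]

end Step

/-! ### Non-explosion -/

theorem ae_clock_nonneg (S : QuadSystem d r) : ∀ᵐ ω ∂(noiseLaw S), ∀ α, 0 ≤ (ω α).1 := by
  rw [ae_all_iff]
  intro α
  have h : MeasurePreserving (fun ω : Noise d => (ω α).1) (noiseLaw S)
      (ProbabilityTheory.expMeasure 1) :=
    measurePreserving_fst.comp (measurePreserving_eval_infinitePi (fun _ : Label => markLaw S) α)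
  exact h.quasiMeasurePreserving.ae ae_expMeasure_nonneg

theorem clock_mul_nonneg (S : QuadSystem d r) (k : Site d) {x : ℝ} (hx : 0 ≤ x) :
    0 ≤ (S.rate k)⁻¹ * x :=
  mul_nonneg (inv_nonneg.2 (S.rate_pos k).le) hx

theorem deathTime_nonneg (S : QuadSystem d r) (k : Site d) {ω : Noise d}
    (hω : ∀ α, 0 ≤ (ω α).1) (α : Label) : 0 ≤ deathTime S k ω α := by
  induction α with
  | nil => exact clock_mul_nonneg S k (hω [])
  | cons i α ih => exact add_nonneg ih (clock_mul_nonneg S _ (hω _))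

theorem birthTime_nonneg (S : QuadSystem d r) (k : Site d) {ω : Noise d}
    (hω : ∀ α, 0 ≤ (ω α).1) (α : Label) : 0 ≤ birthTime S k ω α := by
  cases α with
  | nil => exact le_rfl
  | cons i α => exact deathTime_nonneg S k hω α

theorem birthTime_le_deathTime (S : QuadSystem d r) (k : Site d) {ω : Noise d}
    (hω : ∀ α, 0 ≤ (ω α).1) (α : Label) : birthTime S k ω α ≤ deathTime S k ω α := by
  cases α with
  | nil => exact clock_mul_nonneg S k (hω [])
  | cons i α => exact le_add_of_nonneg_right (clock_mul_nonneg S _ (hω _))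

/-- Some particle of generation `N` is born up to time `t`. -/
def BornGen (S : QuadSystem d r) (N : ℕ) (k : Site d) (t : ℝ) (ω : Noise d) : Prop :=
  ∃ α : Label, α.length = N ∧ IsPresent S k ω α ∧ birthTime S k ω α ≤ t

theorem BornGen.of_le {S : QuadSystem d r} {k : Site d} {t : ℝ} {ω : Noise d}
    (hω : ∀ α, 0 ≤ (ω α).1) {N M : ℕ} (hNM : N ≤ M) (h : BornGen S M k t ω) :
    BornGen S N k t ω := by
  induction hNM with
  | refl => exact h
  | step _ ih =>
    refine ih ?_
    obtain ⟨α, hα, hp, hb⟩ := h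
    match α, hα, hp, hb with
    | i :: α, hα, hp, hb =>
      exact ⟨α, by simpa using hα, hp.1, (birthTime_le_deathTime S k hω α).trans hb⟩

theorem measurable_birthTime (S : QuadSystem d r) (k : Site d) (α : Label) :
    Measurable fun ω : Noise d => birthTime S k ω α := by
  cases α with
  | nil => exact measurable_const
  | cons i α => exact measurable_deathTime S k α

theorem measurableSet_bornGen (S : QuadSystem d r) (N : ℕ) (k : Site d) :
    MeasurableSet {x : ℝ × Noise d | BornGen S N k x.1 x.2} := by
  have : {x : ℝ × Noise d | BornGen S N k x.1 x.2} = ⋃ α : {α : Label // α.length = N},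
      (Prod.snd ⁻¹' {ω | IsPresent S k ω α}) ∩ {x | birthTime S k x.2 α ≤ x.1} := by
    ext x
    simp only [BornGen, mem_ofPred_eq, mem_iUnion, mem_inter_iff, mem_preimage, Subtype.exists,
      exists_prop]
  rw [this]
  exact MeasurableSet.iUnion fun α => (measurable_snd (measurableSet_isPresent S k α)).inter
    (measurableSet_le ((measurable_birthTime S k α).comp measurable_snd) measurable_fst)

open Classical in
/-- The indicator of `BornGen`. -/
def bornInd (S : QuadSystem d r) (N : ℕ) (k : Site d) (t : ℝ) (ω : Noise d) : ℝ≥0∞ :=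
  if BornGen S N k t ω then 1 else 0

theorem measurable_bornInd (S : QuadSystem d r) (N : ℕ) (k : Site d) :
    Measurable (Function.uncurry (bornInd S N k)) :=
  Measurable.ite (measurableSet_bornGen S N k) measurable_const measurable_const

/-- The number of immediate subtrees in which generation `N` is reached, as a function of the
data at the root. -/
def bornStep (S : QuadSystem d r) (N : ℕ) (k : Site d) (s : ℝ) (z : Rest d) : ℝ≥0∞ :=
  ‖uInd (flipSet S k) z.1‖ₑ * bornInd S N k s z.2.2.1 + ‖uInd (branchSet S k) z.1‖ₑ *
    (bornInd S N z.2.1.1 s z.2.2.2.1 + bornInd S N z.2.1.2 s z.2.2.2.2)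

theorem measurable_bornPair (S : QuadSystem d r) (N : ℕ) :
    Measurable fun x : ℝ × (Site d × Site d) × Noise d × Noise d =>
      bornInd S N x.2.1.1 x.1 x.2.2.1 + bornInd S N x.2.1.2 x.1 x.2.2.2 := by
  refine measurable_countable_param (C := Site d × Site d)
    (c := fun x : ℝ × (Site d × Site d) × Noise d × Noise d => x.2.1)
    (H := fun c x => bornInd S N c.1 x.1 x.2.2.1 + bornInd S N c.2 x.1 x.2.2.2) (fun c => ?_)
    (by fun_prop)
  exact ((measurable_bornInd S N c.1).comp (f := fun x : ℝ × (Site d × Site d) × Noise d × Noise d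
    => (x.1, x.2.2.1)) (by fun_prop)).add ((measurable_bornInd S N c.2).comp
      (f := fun x : ℝ × (Site d × Site d) × Noise d × Noise d => (x.1, x.2.2.2)) (by fun_prop))

theorem measurable_uInd_enorm {W : Type*} [MeasurableSpace W] {I : Set unitInterval}
    (hI : MeasurableSet I) {f : W → unitInterval} (hf : Measurable f) :
    Measurable fun w => ‖uInd I (f w)‖ₑ :=
  (measurable_uInd hI).enorm.comp hf

theorem measurable_bornStep (S : QuadSystem d r) (N : ℕ) (k : Site d) :
    Measurable (Function.uncurry (bornStep S N k)) := by
  refine ((measurable_uInd_enorm (measurableSet_flipSet S k) (by fun_prop)).mul ?_).add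
    ((measurable_uInd_enorm (measurableSet_branchSet S k) (by fun_prop)).mul ?_)
  · exact (measurable_bornInd S N k).comp (f := fun x : ℝ × Rest d => (x.1, x.2.2.2.1))
      (by fun_prop)
  · exact (measurable_bornPair S N).comp
      (f := fun x : ℝ × Rest d => (x.1, x.2.2.1, x.2.2.2.2)) (by fun_prop)

theorem isPresent_zero (S : QuadSystem d r) (k : Site d) (ω : Noise d) :
    IsPresent S k ω [0] ↔ (rest k ω).1 ∈ flipSet S k := by
  simp [IsPresent, flipSet, rest, fullPos]

theorem isPresent_one (S : QuadSystem d r) (k : Site d) (ω : Noise d) :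
    IsPresent S k ω [1] ↔ (rest k ω).1 ∈ branchSet S k := by
  simp [IsPresent, branchSet, rest, fullPos]

theorem isPresent_two (S : QuadSystem d r) (k : Site d) (ω : Noise d) :
    IsPresent S k ω [2] ↔ (rest k ω).1 ∈ branchSet S k := by
  simp [IsPresent, branchSet, rest, fullPos]

/-- This is a union bound: a particle of generation `N + 1` descends from an existing child of the
root, and that child's tree reaches generation `N` in the time left. -/
theorem bornInd_succ_le (S : QuadSystem d r) (N : ℕ) (k : Site d) (t : ℝ) {ω : Noise d}
    (hω : ∀ α, 0 ≤ (ω α).1) : bornInd S (N + 1) k t ω ≤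
      open Classical in if 0 ≤ (ω []).1 ∧ (ω []).1 ≤ S.rate k * t then
        bornStep S N k (t - (S.rate k)⁻¹ * (ω []).1) (rest k ω) else 0 := by
  unfold bornInd
  split_ifs with h h1 h1
  · obtain ⟨α, hα, hp, hb⟩ := h
    rcases List.eq_nil_or_concat α with rfl | ⟨α, i, rfl⟩
    · simp at hα
    rw [List.concat_eq_append] at hα hp hb
    rw [birthTime_append] at hb
    obtain ⟨hi, hp⟩ := (isPresent_append S k ω i α).1 hp
    have hlen : α.length = N := by simpa using hα
    have hgen : BornGen S N (fullPos k ω [i]) (t - (S.rate k)⁻¹ * (ω []).1) (shiftNoise i ω) :=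
      ⟨α, hlen, hp, by rw [deathTime] at hb; linarith⟩
    unfold bornStep
    fin_cases i
    · have hu : (rest k ω).1 ∈ flipSet S k := (isPresent_zero S k ω).1 hi
      have hg : bornInd S N k (t - (S.rate k)⁻¹ * (ω []).1) (rest k ω).2.2.1 = 1 :=
        if_pos (by simpa [fullPos, rest] using hgen)
      refine le_add_right ?_
      simp [uInd, hu, hg]
    · have hu : (rest k ω).1 ∈ branchSet S k := (isPresent_one S k ω).1 hi
      have hg : bornInd S N (rest k ω).2.1.1 (t - (S.rate k)⁻¹ * (ω []).1)
        (rest k ω).2.2.2.1 = 1 := if_pos (by simpa [fullPos, rest] using hgen)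
      refine le_add_left ?_
      simp [uInd, hu, hg]
    · have hu : (rest k ω).1 ∈ branchSet S k := (isPresent_two S k ω).1 hi
      have hg : bornInd S N (rest k ω).2.1.2 (t - (S.rate k)⁻¹ * (ω []).1)
        (rest k ω).2.2.2.2 = 1 := if_pos (by simpa [fullPos, rest] using hgen)
      refine le_add_left ?_
      simp [uInd, hu, hg]
  -- If the root outlives `t`, no descendant can be born by then, because birth times inside a
  -- subtree are nonnegative.
  · exfalso
    obtain ⟨α, hα, hp, hb⟩ := h
    rcases List.eq_nil_or_concat α with rfl | ⟨α, i, rfl⟩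
    · simp at hα
    rw [List.concat_eq_append, birthTime_append] at hb
    have hb' := birthTime_nonneg S (fullPos k ω [i]) (ω := shiftNoise i ω)
      (fun β => hω _) α
    refine h1 ⟨hω [], ?_⟩
    rw [← inv_mul_le_iff₀ (S.rate_pos k)]
    rw [deathTime] at hb
    linarith
  · exact zero_le
  · exact zero_le

theorem lintegral_bornStep_le (S : QuadSystem d r) (N : ℕ) (k : Site d) {s b : ℝ} (hb : 0 ≤ b)
    (h : ∀ l, ∫⁻ ω, bornInd S N l s ω ∂(noiseLaw S) ≤ ENNReal.ofReal b) :
    ∫⁻ z, bornStep S N k s z ∂(restLaw S k) ≤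
      ENNReal.ofReal (2 * (S.p k + S.qtot k) * b) := by
  have hp := (S.p_mem k).1
  have hq := S.qtot_nonneg k
  have hm (l : Site d) : Measurable (bornInd S N l s) := measurable_slice (measurable_bornInd S N l) s
  have hpair : Measurable fun z : (Site d × Site d) × Noise d × Noise d =>
      bornInd S N z.1.1 s z.2.1 + bornInd S N z.1.2 s z.2.2 :=
    (measurable_bornPair S N).comp (measurable_prodMk_left (x := s))
  have hflip : ∫⁻ z : Rest d, ‖uInd (flipSet S k) z.1‖ₑ * bornInd S N k s z.2.2.1 ∂(restLaw S k)
      ≤ ENNReal.ofReal (S.p k * b) := by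
    have h1 := (measurePreserving_restFlip S k).lintegral_comp
      (f := fun x => ‖uInd (flipSet S k) x.1‖ₑ * bornInd S N k s x.2)
      ((measurable_uInd_enorm (measurableSet_flipSet S k) measurable_fst).mul
        ((hm k).comp measurable_snd))
    rw [h1, lintegral_uInd_mul _ (measurableSet_flipSet S k) (volume_flipSet S k) (hm k),
      ENNReal.ofReal_mul hp]
    exact mul_le_mul' le_rfl (h k)
  have hbranch : ∫⁻ z : Rest d, ‖uInd (branchSet S k) z.1‖ₑ *
      (bornInd S N z.2.1.1 s z.2.2.2.1 + bornInd S N z.2.1.2 s z.2.2.2.2) ∂(restLaw S k)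
      ≤ ENNReal.ofReal (S.qtot k * (b + b)) := by
    have h1 := (measurePreserving_restBranch S k).lintegral_comp
      (f := fun x => ‖uInd (branchSet S k) x.1‖ₑ *
        (bornInd S N x.2.1.1 s x.2.2.1 + bornInd S N x.2.1.2 s x.2.2.2))
      ((measurable_uInd_enorm (measurableSet_branchSet S k) measurable_fst).mul
        (hpair.comp measurable_snd))
    rw [h1, lintegral_uInd_mul _ (measurableSet_branchSet S k) (volume_branchSet S k) hpair,
      ENNReal.ofReal_mul hq, lintegral_prod _ hpair.aemeasurable]
    refine mul_le_mul' le_rfl ?_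
    calc _ ≤ ∫⁻ _, ENNReal.ofReal (b + b) ∂(offLaw S k) := by
          refine lintegral_mono fun lm => ?_
          have h2 : ∫⁻ y : Noise d × Noise d, bornInd S N lm.1 s y.1 + bornInd S N lm.2 s y.2
              ∂((noiseLaw S).prod (noiseLaw S)) ≤ ENNReal.ofReal (b + b) := by
            have e1 := (measurePreserving_fst (μ := noiseLaw S) (ν := noiseLaw S)).lintegral_comp
              (hm lm.1)
            have e2 := (measurePreserving_snd (μ := noiseLaw S) (ν := noiseLaw S)).lintegral_comp
              (hm lm.2)
            have hm1 : Measurable fun y : Noise d × Noise d => bornInd S N lm.1 s y.1 :=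
              (hm _).comp measurable_fst
            rw [lintegral_add_left hm1, e1, e2, ENNReal.ofReal_add hb hb]
            exact add_le_add (h _) (h _)
          exact h2
      _ = _ := by simp
  have hm1 : Measurable fun z : Rest d =>
      ‖uInd (flipSet S k) z.1‖ₑ * bornInd S N k s z.2.2.1 :=
    (measurable_uInd_enorm (measurableSet_flipSet S k) measurable_fst).mul
      ((hm k).comp (by fun_prop))
  unfold bornStep
  rw [lintegral_add_left hm1]
  refine (add_le_add hflip hbranch).trans ?_
  rw [← ENNReal.ofReal_add (by positivity) (by positivity)]
  refine ENNReal.ofReal_le_ofReal ?_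
  -- A flip leaves one subtree and a branching two; counting the flip twice gives the common factor
  -- `2(p_k + q_k)`.
  have : 0 ≤ S.p k * b := by positivity
  nlinarith

/-- In the sup norm over modes weighted by `e^{βt}`, each generation costs a factor `1/2`. The rates
need not be bounded. -/
theorem exists_lintegral_bornInd_le (S : QuadSystem d r) : ∃ β : ℝ, ∀ N k t, 0 ≤ t →
    ∫⁻ ω, bornInd S N k t ω ∂(noiseLaw S) ≤ ENNReal.ofReal ((1 / 2) ^ N * Real.exp (β * t)) := by
  obtain ⟨β, hβ, h⟩ := S.exists_contraction (A := 2) (by norm_num)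
  refine ⟨β, fun N => ?_⟩
  induction N with
  | zero =>
    intro k t ht
    calc _ ≤ ∫⁻ _, 1 ∂(noiseLaw S) := by
          refine lintegral_mono fun ω => ?_
          unfold bornInd
          split_ifs <;> simp
      _ ≤ _ := by
          rw [lintegral_one, measure_univ, ← ENNReal.ofReal_one]
          refine ENNReal.ofReal_le_ofReal ?_
          simpa using mul_nonneg hβ ht
  | succ N ih =>
    intro k t ht
    have hl := S.rate_pos k
    have hpq : 0 ≤ S.p k + S.qtot k := add_nonneg (S.p_mem k).1 (S.qtot_nonneg k)
    classical
    have hstep := lintegral_renewal_le (restLaw S k) (measurable_bornStep S N k) (t := t)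
      (b := 2 * (S.p k + S.qtot k) * (1 / 2) ^ N) hl (by positivity) hβ fun s hs _ => by
        rw [mul_assoc (2 * _)]
        exact lintegral_bornStep_le S N k (by positivity) fun l => ih l s hs
    have hmeas : Measurable fun x : ℝ × Rest d => if 0 ≤ x.1 ∧ x.1 ≤ S.rate k * t then
        bornStep S N k (t - (S.rate k)⁻¹ * x.1) x.2 else 0 := by
      refine Measurable.ite ((measurableSet_le measurable_const measurable_fst).inter
        (measurableSet_le measurable_fst measurable_const)) ?_ measurable_const
      exact (measurable_bornStep S N k).comp
        ((measurable_const.sub (measurable_fst.const_mul _)).prodMk measurable_snd)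
    calc _ ≤ ∫⁻ ω, (if 0 ≤ (ω []).1 ∧ (ω []).1 ≤ S.rate k * t then
          bornStep S N k (t - (S.rate k)⁻¹ * (ω []).1) (rest k ω) else 0) ∂(noiseLaw S) := by
          refine lintegral_mono_ae ?_
          filter_upwards [ae_clock_nonneg S] with ω hω
          convert bornInd_succ_le S N k t hω
      _ = _ := (measurePreserving_root S k).lintegral_comp hmeas
      _ ≤ _ := hstep
      _ ≤ _ := by
          refine ENNReal.ofReal_le_ofReal (mul_le_mul_of_nonneg_right ?_ (Real.exp_nonneg _))
          have h1 := mul_le_mul_of_nonneg_right (h k) (by positivity : (0 : ℝ) ≤ (1 / 2) ^ N)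
          rw [pow_succ']
          linarith

/-- Almost surely, only finitely many particles are born up to time `t`. -/
theorem ae_finite_bornBefore (S : QuadSystem d r) (k : Site d) {t : ℝ} (ht : 0 ≤ t) :
    ∀ᵐ ω ∂(noiseLaw S), (bornBefore t (branchingTree S k ω)).Finite := by
  obtain ⟨β, hβ⟩ := exists_lintegral_bornInd_le S
  have hnull : noiseLaw S {ω | ∀ N, BornGen S N k t ω} = 0 := by
    have hlim : Tendsto (fun N : ℕ => ENNReal.ofReal ((1 / 2) ^ N * Real.exp (β * t))) atTop
        (nhds 0) := by
      rw [← ENNReal.ofReal_zero]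
      refine ENNReal.tendsto_ofReal ?_
      simpa using (tendsto_pow_atTop_nhds_zero_of_lt_one (by norm_num : (0 : ℝ) ≤ 1 / 2)
        (by norm_num)).mul_const (Real.exp (β * t))
    refine le_antisymm (ge_of_tendsto' hlim fun N => ?_) zero_le
    refine le_trans ?_ (hβ N k t ht)
    have hm : MeasurableSet {ω | BornGen S N k t ω} :=
      (measurable_prodMk_left (x := t)) (measurableSet_bornGen S N k)
    calc _ ≤ noiseLaw S {ω | BornGen S N k t ω} := measure_mono (ofPred_subset_ofPred.2 fun ω hω => hω N)
      _ = ∫⁻ ω, {ω | BornGen S N k t ω}.indicator 1 ω ∂(noiseLaw S) :=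
          (lintegral_indicator_one hm).symm
      _ ≤ _ := by
          refine lintegral_mono fun ω => ?_
          by_cases hω : BornGen S N k t ω <;> simp [bornInd, hω]
  have hae : ∀ᵐ ω ∂(noiseLaw S), ¬ ∀ N, BornGen S N k t ω := by
    rw [ae_iff]
    simpa using hnull
  filter_upwards [hae, ae_clock_nonneg S] with ω h1 hω
  obtain ⟨N, hN⟩ := not_forall.1 h1
  -- An unreached generation blocks all later ones, so every particle born by `t` has one of the
  -- finitely many labels shorter than `N`.
  refine (List.finite_length_lt (Fin 3) N).subset fun α hα => ?_
  by_contra hlen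
  refine hN (BornGen.of_le hω (not_lt.1 hlen) ⟨α, rfl, ?_, hα.2⟩)
  by_contra hp
  exact hα.1 (if_neg hp)

/-! ### Modifying the forcing on a null set -/

/-- Every lineage begins with the lifetime of the root, so each death time has the root's clock as
an independent summand. This alone makes its law absolutely continuous. -/
theorem exists_deathTime_eq (S : QuadSystem d r) (k : Site d) (α : Label) :
    ∃ W : Rest d → ℝ, Measurable W ∧
      ∀ ω, deathTime S k ω α = (S.rate k)⁻¹ * (ω []).1 + W (rest k ω) := by
  rcases List.eq_nil_or_concat α with rfl | ⟨α, i, rfl⟩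
  · exact ⟨0, measurable_zero, fun ω => (add_zero _).symm⟩
  rw [List.concat_eq_append]
  fin_cases i
  · refine ⟨fun z => deathTime S k z.2.2.1 α, (measurable_deathTime S k α).comp (by fun_prop),
      fun ω => ?_⟩
    exact deathTime_append S k ω 0 α
  · refine ⟨fun z => deathTime S z.2.1.1 z.2.2.2.1 α, ?_, fun ω => deathTime_append S k ω 1 α⟩
    exact measurable_countable_param (C := Site d) (c := fun z : Rest d => z.2.1.1)
      (H := fun c z => deathTime S c z.2.2.2.1 α)
      (fun c => (measurable_deathTime S c α).comp (f := fun z : Rest d => z.2.2.2.1) (by fun_prop))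
      (by fun_prop)
  · refine ⟨fun z => deathTime S z.2.1.2 z.2.2.2.2 α, ?_, fun ω => deathTime_append S k ω 2 α⟩
    exact measurable_countable_param (C := Site d) (c := fun z : Rest d => z.2.1.2)
      (H := fun c z => deathTime S c z.2.2.2.2 α)
      (fun c => (measurable_deathTime S c α).comp (f := fun z : Rest d => z.2.2.2.2) (by fun_prop))
      (by fun_prop)

/-- Death times avoid any given null set. -/
theorem ae_deathTime_notMem (S : QuadSystem d r) (k : Site d) (α : Label) {A : Set ℝ}
    (hA : MeasurableSet A) (hA0 : volume A = 0) :
    ∀ᵐ ω ∂(noiseLaw S), deathTime S k ω α ∉ A := by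
  obtain ⟨W, hW, hdec⟩ := exists_deathTime_eq S k α
  have hl : (S.rate k)⁻¹ ≠ 0 := (inv_pos.2 (S.rate_pos k)).ne'
  have hm : MeasurableSet {x : ℝ × Rest d | (S.rate k)⁻¹ * x.1 + W x.2 ∉ A} :=
    (((measurable_fst.const_mul _).add (hW.comp measurable_snd)) hA).compl
  have hprod : ∀ᵐ x ∂((ProbabilityTheory.expMeasure 1).prod (restLaw S k)),
      (S.rate k)⁻¹ * x.1 + W x.2 ∉ A := by
    -- With the rest frozen, the death time is a nonconstant affine function of the clock, and such
    -- a map pulls null sets back to null sets.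
    rw [Measure.ae_prod_iff_ae_ae hm, Measure.ae_ae_comm hm]
    refine Eventually.of_forall fun z => expMeasure_ac.ae_le ?_
    have h1 : volume ((fun x : ℝ => (S.rate k)⁻¹ * x) ⁻¹' ((fun y => y + W z) ⁻¹' A)) = 0 := by
      rw [Real.volume_preimage_mul_left hl, measure_preimage_add_right, hA0, mul_zero]
    filter_upwards [compl_mem_ae_iff.2 h1] with x hx using hx
  filter_upwards [(measurePreserving_root S k).quasiMeasurePreserving.ae hprod] with ω hω
  rwa [hdec]

/-- The recursion reads the forcing only at the times `t - t_α`: successive shifts subtract the same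
amount from the horizon and from the death times. -/
theorem evalApprox_congr_forcing (S : QuadSystem d r) (χ₀ : Site d → Val r)
    {γ γ' : Site d → ℝ → Val r} (N : ℕ) : ∀ (n : ℕ) (t : ℝ) (T : Tree d),
      (∀ α k, death T α < t → γ k (t - death T α) = γ' k (t - death T α)) →
      evalApprox S χ₀ γ N n t T = evalApprox S χ₀ γ' N n t T := by
  induction N with
  | zero => intros; rfl
  | succ N ih =>
    intro n t T h
    rcases h0 : pos T [] with _ | k
    · simp [evalApprox, h0]
    by_cases ht : t ≤ death T []
    · simp [evalApprox, h0, ht]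
    have key (i : Fin 3) (n : ℕ) := ih n (t - death T []) (shift i T) fun α k hα => by
      have h1 := h (α ++ [i]) k
      simp only [death, shift] at h1 hα ⊢
      rw [sub_sub_sub_cancel_right]
      exact h1 (by linarith)
    cases n with
    | zero => simp [evalApprox, h0, ht]
    | succ n => simp only [evalApprox, h0, ht, if_false, key, h [] k (not_le.1 ht)]

/-- There are countably many labels, so almost surely all the times `t - t_α` avoid the null set on
which the two forcings differ. -/
theorem ae_prunedEval_congr (S : QuadSystem d r) (χ₀ : Site d → Val r)
    {γ γ' : Site d → ℝ → Val r} {T : ℝ}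
    (h : ∀ᵐ s ∂(volume.restrict (Icc 0 T)), ∀ k, γ k s = γ' k s) (n : ℕ) (k : Site d)
    {t : ℝ} (ht : t ≤ T) :
    prunedEval S χ₀ γ n t =ᵐ[treeLaw S k] prunedEval S χ₀ γ' n t := by
  rw [ae_restrict_iff' measurableSet_Icc, ae_iff] at h
  obtain ⟨A, hsub, hA, hA0⟩ := exists_measurable_superset_of_null h
  have hA' : MeasurableSet ((fun s => t - s) ⁻¹' A) := (by fun_prop : Measurable _) hA
  have hA0' : volume ((fun s => t - s) ⁻¹' A) = 0 := by
    rw [(Measure.measurePreserving_sub_left volume t).measure_preimage hA.nullMeasurableSet, hA0]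
  have hnoise : ∀ᵐ ω ∂(noiseLaw S), ∀ α, 0 ≤ deathTime S k ω α ∧ t - deathTime S k ω α ∉ A := by
    rw [ae_all_iff]
    intro α
    filter_upwards [ae_clock_nonneg S, ae_deathTime_notMem S k α hA' hA0'] with ω h1 h2
    exact ⟨deathTime_nonneg S k h1 α, h2⟩
  have htree : ∀ᵐ τ ∂(treeLaw S k), ∀ α, 0 ≤ death τ α ∧ t - death τ α ∉ A := by
    refine (ae_map_iff (measurable_branchingTree S k).aemeasurable ?_).2 hnoise
    have hd (α : Label) : Measurable fun τ : Tree d => death τ α :=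
      (measurable_pi_apply α).snd.snd
    exact measurableSet_setOfPred.2 (Measurable.forall fun α =>
      (measurableSet_setOfPred.1 (measurableSet_le measurable_const (hd α))).and
        (measurableSet_setOfPred.1 ((measurable_const.sub (hd α)) hA).compl))
  filter_upwards [htree] with τ hτ
  have heq (N : ℕ) : evalApprox S χ₀ γ N n t τ = evalApprox S χ₀ γ' N n t τ := by
    refine evalApprox_congr_forcing S χ₀ N n t τ fun α k hα => ?_
    by_contra hne
    refine (hτ α).2 (hsub fun hall => hne (hall ⟨by linarith, ?_⟩ k))
    have := (hτ α).1
    linarith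
  classical
  -- The evaluation depends on the forcing only through the sequence of approximations.
  exact congrArg (fun F : ℕ → Val r =>
    if h : ∃ v, ∀ᶠ N in atTop, F N = v then h.choose else 0) (funext heq)

/-! ### Measurability of the pruned evaluation -/

instance : DiscreteMeasurableSpace (Position d) := ⟨fun _ => trivial⟩

theorem measurable_pos (α : Label) : Measurable fun T : Tree d => pos T α :=
  (measurable_pi_apply α).fst

theorem measurable_death (α : Label) : Measurable fun T : Tree d => death T α :=
  (measurable_pi_apply α).snd.snd

theorem measurable_shift (i : Fin 3) : Measurable (shift (d := d) i) :=
  measurable_pi_lambda _ fun α => (measurable_pos (α ++ [i])).prodMk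
    ((((measurable_pi_apply (α ++ [i])).snd.fst).sub (measurable_death [])).prodMk
      ((measurable_death (α ++ [i])).sub (measurable_death [])))

/-- The positions of the root and its three children take countably many values. Fixing them selects
a single branch of the recursion, measurable by induction on the depth. -/
theorem measurable_evalApprox (S : QuadSystem d r) (χ₀ : Site d → Val r)
    {γ : Site d → ℝ → Val r} (hγ : ∀ k, Measurable (γ k)) (N : ℕ) : ∀ n,
      Measurable fun x : ℝ × Tree d => evalApprox S χ₀ γ N n x.1 x.2 := by
  induction N with
  | zero => exact fun n => measurable_const
  | succ N ih =>
    intro n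
    have hdeath : Measurable fun x : ℝ × Tree d => x.1 - death x.2 [] :=
      measurable_fst.sub ((measurable_death []).comp measurable_snd)
    have hset : MeasurableSet {x : ℝ × Tree d | x.1 ≤ death x.2 []} :=
      measurableSet_le measurable_fst ((measurable_death []).comp measurable_snd)
    have hsub (i : Fin 3) (n : ℕ) : Measurable fun x : ℝ × Tree d =>
        evalApprox S χ₀ γ N n (x.1 - death x.2 []) (shift i x.2) :=
      (ih n).comp (hdeath.prodMk ((measurable_shift i).comp measurable_snd))
    have hcase (c : Position d × Position d × Position d × Position d) :
        ∃ g : ℝ × Tree d → Val r, Measurable g ∧ ∀ x,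
          (pos x.2 [], pos x.2 [0], pos x.2 [1], pos x.2 [2]) = c →
            evalApprox S χ₀ γ (N + 1) n x.1 x.2 = g x := by
      obtain ⟨c, c0, c1, c2⟩ := c
      simp only [Prod.mk.injEq]
      rcases c with _ | k
      · exact ⟨0, measurable_zero, fun x hx => by simp [evalApprox, hx.1]⟩
      suffices H : ∃ g : ℝ × Tree d → Val r, Measurable g ∧ ∀ x : ℝ × Tree d,
          ¬ x.1 ≤ death x.2 [] →
          pos x.2 [] = some k ∧ pos x.2 [0] = c0 ∧ pos x.2 [1] = c1 ∧ pos x.2 [2] = c2 →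
            evalApprox S χ₀ γ (N + 1) n x.1 x.2 = g x by
        obtain ⟨g, hg, heq⟩ := H
        classical
        refine ⟨fun x => if x.1 ≤ death x.2 [] then χ₀ k else g x,
          Measurable.ite hset measurable_const hg, fun x hx => ?_⟩
        by_cases ht : x.1 ≤ death x.2 []
        · simp [evalApprox, hx.1, ht]
        · rw [heq x ht hx]
          exact (if_neg ht).symm
      rcases n with _ | n
      · exact ⟨0, measurable_zero, fun x ht hx => by simp [evalApprox, hx.1, ht]⟩
      rcases c0 with _ | j <;> rcases c1 with _ | l <;> rcases c2 with _ | m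
      · exact ⟨_, (hγ k).comp hdeath, fun x ht hx => by simp [evalApprox, hx, ht]⟩
      · exact ⟨0, measurable_zero, fun x ht hx => by simp [evalApprox, hx, ht]⟩
      · exact ⟨0, measurable_zero, fun x ht hx => by simp [evalApprox, hx, ht]⟩
      · exact ⟨_, (measurable_B S k l m (hsub 1 (n + 1)) (hsub 2 n)).const_smul S.Cb,
          fun x ht hx => by simp [evalApprox, hx, ht]⟩
      · exact ⟨_, (hsub 0 (n + 1)).const_smul S.Cf,
          fun x ht hx => by simp [evalApprox, hx, ht]⟩
      · exact ⟨0, measurable_zero, fun x ht hx => by simp [evalApprox, hx, ht]⟩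
      · exact ⟨0, measurable_zero, fun x ht hx => by simp [evalApprox, hx, ht]⟩
      · exact ⟨0, measurable_zero, fun x ht hx => by simp [evalApprox, hx, ht]⟩
    choose g hg heq using hcase
    have hP : Measurable fun x : ℝ × Tree d =>
        (pos x.2 [], pos x.2 [0], pos x.2 [1], pos x.2 [2]) :=
      ((measurable_pos _).comp measurable_snd).prodMk
        (((measurable_pos _).comp measurable_snd).prodMk
          (((measurable_pos _).comp measurable_snd).prodMk
            ((measurable_pos _).comp measurable_snd)))
    have := measurable_countable_param hg hP
    convert this using 2 with x
    exact heq _ x rfl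

theorem measurable_prunedEval (S : QuadSystem d r) (χ₀ : Site d → Val r)
    {γ : Site d → ℝ → Val r} (hγ : ∀ k, Measurable (γ k)) (n : ℕ) :
    Measurable fun x : ℝ × Tree d => prunedEval S χ₀ γ n x.1 x.2 := by
  classical
  have hf (N : ℕ) := measurable_evalApprox S χ₀ hγ N n
  set f : ℕ → ℝ × Tree d → Val r := fun N x => evalApprox S χ₀ γ N n x.1 x.2 with hfdef
  have hA (N : ℕ) : MeasurableSet {x | ∀ M, N ≤ M → f M x = f N x} := by
    have : {x | ∀ M, N ≤ M → f M x = f N x} = ⋂ M, ⋂ (_ : N ≤ M), {x | f M x = f N x} := by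
      ext x
      simp
    rw [this]
    exact MeasurableSet.iInter fun M => MeasurableSet.iInter fun _ =>
      measurableSet_eq_fun (hf M) (hf N)
  -- An approximation is kept only where it no longer changes from depth `N` on. Where the sequence
  -- never stabilizes, the limit is then the default value `0`, even if the approximations converge.
  refine measurable_of_tendsto_metrizable
    (f := fun N x => if ∀ M, N ≤ M → f M x = f N x then f N x else 0)
    (fun N => Measurable.ite (hA N) (hf N) measurable_const) ?_
  rw [tendsto_pi_nhds]
  intro x
  refine tendsto_const_nhds.congr' ?_
  by_cases h : ∃ v, ∀ᶠ N in atTop, f N x = v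
  · have hv : ∀ᶠ N in atTop, f N x = prunedEval S χ₀ γ n x.1 x.2 := by
      rw [prunedEval, dif_pos h]
      exact h.choose_spec
    obtain ⟨N₀, hN₀⟩ := eventually_atTop.1 hv
    filter_upwards [eventually_ge_atTop N₀] with N hN
    rw [if_pos fun M hM => (hN₀ M (hN.trans hM)).trans (hN₀ N hN).symm, hN₀ N hN]
  · refine Eventually.of_forall fun N => ?_
    rw [prunedEval, dif_neg h]
    exact (if_neg fun hN => h ⟨f N x, eventually_atTop.2 ⟨N, hN⟩⟩).symm

/-! ### The first-step identities -/

/-- The approximate evaluation of the tree rooted at `k`, as a function of the noise. -/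
def approxOn (S : QuadSystem d r) (χ₀ : Site d → Val r) (γ : Site d → ℝ → Val r) (N n : ℕ)
    (k : Site d) (t : ℝ) (ω : Noise d) : Val r :=
  evalApprox S χ₀ γ N n t (branchingTree S k ω)

/-- The pruned evaluation of the tree rooted at `k`, as a function of the noise. -/
def prunedOn (S : QuadSystem d r) (χ₀ : Site d → Val r) (γ : Site d → ℝ → Val r) (n : ℕ)
    (k : Site d) (t : ℝ) (ω : Noise d) : Val r :=
  prunedEval S χ₀ γ n t (branchingTree S k ω)

theorem measurable_approxOn (S : QuadSystem d r) (χ₀ : Site d → Val r)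
    {γ : Site d → ℝ → Val r} (hγ : ∀ k, Measurable (γ k)) (N n : ℕ) (k : Site d) :
    Measurable (Function.uncurry (approxOn S χ₀ γ N n k)) :=
  (measurable_evalApprox S χ₀ hγ N n).comp
    (measurable_fst.prodMk ((measurable_branchingTree S k).comp measurable_snd))

theorem measurable_prunedOn (S : QuadSystem d r) (χ₀ : Site d → Val r)
    {γ : Site d → ℝ → Val r} (hγ : ∀ k, Measurable (γ k)) (n : ℕ) (k : Site d) :
    Measurable (Function.uncurry (prunedOn S χ₀ γ n k)) :=
  (measurable_prunedEval S χ₀ hγ n).comp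
    (measurable_fst.prodMk ((measurable_branchingTree S k).comp measurable_snd))

theorem pos_branchingTree_root (S : QuadSystem d r) (k : Site d) (ω : Noise d) :
    pos (branchingTree S k ω) [] = some k := by
  simp [pos, branchingTree, IsPresent, fullPos]

theorem pos_branchingTree_of_present (S : QuadSystem d r) (k : Site d) (ω : Noise d)
    {α : Label} (h : IsPresent S k ω α) : pos (branchingTree S k ω) α = some (fullPos k ω α) :=
  if_pos h

theorem pos_branchingTree_of_not_present (S : QuadSystem d r) (k : Site d) (ω : Noise d)
    {α : Label} (h : ¬ IsPresent S k ω α) : pos (branchingTree S k ω) α = none :=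
  if_neg h

/-- Away from a null set, exactly one of death, flip and branching happens at the root. -/
theorem root_cases (S : QuadSystem d r) (k : Site d) {ω : Noise d}
    (h : (rest k ω).1 ∉ flipSet S k ∩ branchSet S k) :
    let T := branchingTree S k ω
    (((rest k ω).1 ∈ dieSet S k ∧ (rest k ω).1 ∉ flipSet S k ∧ (rest k ω).1 ∉ branchSet S k) ∧
      pos T [0] = none ∧ pos T [1] = none ∧ pos T [2] = none) ∨
    (((rest k ω).1 ∉ dieSet S k ∧ (rest k ω).1 ∈ flipSet S k ∧ (rest k ω).1 ∉ branchSet S k) ∧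
      pos T [0] = some k ∧ pos T [1] = none ∧ pos T [2] = none ∧
      shift 0 T = branchingTree S k (rest k ω).2.2.1) ∨
    (((rest k ω).1 ∉ dieSet S k ∧ (rest k ω).1 ∉ flipSet S k ∧ (rest k ω).1 ∈ branchSet S k) ∧
      pos T [0] = none ∧ pos T [1] = some (rest k ω).2.1.1 ∧ pos T [2] = some (rest k ω).2.1.2 ∧
      shift 1 T = branchingTree S (rest k ω).2.1.1 (rest k ω).2.2.2.1 ∧
      shift 2 T = branchingTree S (rest k ω).2.1.2 (rest k ω).2.2.2.2) := by
  intro T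
  have n0 (hf : (rest k ω).1 ∉ flipSet S k) : pos T [0] = none :=
    pos_branchingTree_of_not_present S k ω (mt (isPresent_zero S k ω).1 hf)
  have n1 (hf : (rest k ω).1 ∉ branchSet S k) : pos T [1] = none :=
    pos_branchingTree_of_not_present S k ω (mt (isPresent_one S k ω).1 hf)
  have n2 (hf : (rest k ω).1 ∉ branchSet S k) : pos T [2] = none :=
    pos_branchingTree_of_not_present S k ω (mt (isPresent_two S k ω).1 hf)
  by_cases hf : (rest k ω).1 ∈ flipSet S k
  · have hb : (rest k ω).1 ∉ branchSet S k := fun hb => h ⟨hf, hb⟩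
    have hp := (isPresent_zero S k ω).2 hf
    exact Or.inr (Or.inl ⟨⟨fun hd => not_lt.2 hf hd.1, hf, hb⟩,
      pos_branchingTree_of_present S k ω hp, n1 hb, n2 hb, shift_branchingTree S k ω 0 hp⟩)
  · by_cases hb : (rest k ω).1 ∈ branchSet S k
    · have hp1 := (isPresent_one S k ω).2 hb
      have hp2 := (isPresent_two S k ω).2 hb
      exact Or.inr (Or.inr ⟨⟨fun hd => not_lt.2 hb hd.2, hf, hb⟩, n0 hf,
        pos_branchingTree_of_present S k ω hp1, pos_branchingTree_of_present S k ω hp2,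
        shift_branchingTree S k ω 1 hp1, shift_branchingTree S k ω 2 hp2⟩)
    · exact Or.inl ⟨⟨⟨not_le.1 hf, not_le.1 hb⟩, hf, hb⟩, n0 hf, n1 hb, n2 hb⟩

theorem ae_notMem_flip_inter_branch (S : QuadSystem d r) (k : Site d) :
    ∀ᵐ ω ∂(noiseLaw S), (rest k ω).1 ∉ flipSet S k ∩ branchSet S k := by
  have h : MeasurePreserving (fun ω : Noise d => (rest k ω).1) (noiseLaw S) volume := by
    have h1 : MeasurePreserving (Prod.fst : Rest d → unitInterval) (restLaw S k) volume :=
      measurePreserving_fst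
    exact h1.comp (measurePreserving_snd.comp (measurePreserving_root S k))
  exact h.quasiMeasurePreserving.ae
    (compl_mem_ae_iff.2 (volume_flipSet_inter_branchSet S k))

/-- What the root contributes if it is still alive. -/
def aliveVal (S : QuadSystem d r) (χ₀ : Site d → Val r) (k : Site d) (t : ℝ) (ω : Noise d) :
    Val r :=
  open Classical in if S.rate k * t ≤ (ω []).1 then χ₀ k else 0

theorem le_clock_iff (S : QuadSystem d r) (k : Site d) (t : ℝ) (ω : Noise d) :
    t ≤ death (branchingTree S k ω) [] ↔ S.rate k * t ≤ (ω []).1 := by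
  rw [← le_inv_mul_iff₀ (S.rate_pos k)]
  rfl

theorem approxOn_zero_right (S : QuadSystem d r) (χ₀ : Site d → Val r) (γ : Site d → ℝ → Val r)
    (N : ℕ) (k : Site d) (t : ℝ) (ω : Noise d) :
    approxOn S χ₀ γ (N + 1) 0 k t ω = aliveVal S χ₀ k t ω := by
  have h := le_clock_iff S k t ω
  simp only [approxOn, aliveVal, evalApprox, pos_branchingTree_root, h]

/-- For a nonnegative clock the windows `λt ≤ E` and `0 ≤ E < λt` are complementary, so a case
distinction becomes a sum that can be integrated term by term. -/
theorem first_step (S : QuadSystem d r) (χ₀ : Site d → Val r) {γ : Site d → ℝ → Val r}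
    {X Y : Site d → ℝ → Noise d → Val r} (k : Site d) {t : ℝ} {ω : Noise d}
    (hω : ∀ α, 0 ≤ (ω α).1) {v : Val r}
    (halive : t ≤ death (branchingTree S k ω) [] → v = χ₀ k)
    (hstep : death (branchingTree S k ω) [] < t →
      v = stepVal S γ X Y k (t - death (branchingTree S k ω) []) (rest k ω)) :
    v = aliveVal S χ₀ k t ω +
      renewal (stepVal S γ X Y k) (S.rate k) t ((ω []).1, rest k ω) := by
  have h := le_clock_iff S k t ω
  by_cases ht : S.rate k * t ≤ (ω []).1
  · rw [halive (h.2 ht), aliveVal, if_pos ht, renewal, if_neg fun hc => not_le.2 hc.2 ht, add_zero]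
  · rw [hstep (not_le.1 (mt h.1 ht)), aliveVal, if_neg ht, renewal,
      if_pos ⟨hω [], not_le.1 ht⟩, zero_add]
    rfl

/-- The depth drops in every subtree, but the pruning level drops only along label `2`. This double
indexing lets moments be bounded by induction on depth before the limit is known to be integrable.
-/
theorem ae_approxOn_succ (S : QuadSystem d r) (χ₀ : Site d → Val r) (γ : Site d → ℝ → Val r)
    (N n : ℕ) (k : Site d) (t : ℝ) :
    ∀ᵐ ω ∂(noiseLaw S), approxOn S χ₀ γ (N + 1) (n + 1) k t ω = aliveVal S χ₀ k t ω +
      renewal (stepVal S γ (approxOn S χ₀ γ N (n + 1)) (approxOn S χ₀ γ N n) k) (S.rate k) t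
        ((ω []).1, rest k ω) := by
  filter_upwards [ae_clock_nonneg S, ae_notMem_flip_inter_branch S k] with ω hω hu
  have h0 := pos_branchingTree_root S k ω
  refine first_step S χ₀ k hω (fun ht => ?_) (fun ht => ?_)
  · simp [approxOn, evalApprox, h0, ht]
  · rcases root_cases S k hu with ⟨⟨a, b, c⟩, h⟩ | ⟨⟨a, b, c⟩, h⟩ | ⟨⟨a, b, c⟩, h⟩
    all_goals simp [approxOn, evalApprox, h0, ht.not_ge, h, stepVal, uInd, a, b, c]

/-- Non-explosion enters here: the evaluation satisfies its implicit relations once finitely many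
particles are born. -/
theorem ae_prunedOn (S : QuadSystem d r) (χ₀ : Site d → Val r) (γ : Site d → ℝ → Val r)
    (k : Site d) {t : ℝ} (ht : 0 ≤ t) :
    ∀ᵐ ω ∂(noiseLaw S), prunedOn S χ₀ γ 0 k t ω = aliveVal S χ₀ k t ω ∧
      ∀ n, prunedOn S χ₀ γ (n + 1) k t ω = aliveVal S χ₀ k t ω +
        renewal (stepVal S γ (prunedOn S χ₀ γ (n + 1)) (prunedOn S χ₀ γ n) k) (S.rate k) t
          ((ω []).1, rest k ω) := by
  filter_upwards [ae_clock_nonneg S, ae_notMem_flip_inter_branch S k,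
    ae_finite_bornBefore S k ht] with ω hω hu hfin
  have h0 := pos_branchingTree_root S k ω
  obtain ⟨ha, hd⟩ := prunedEval_implicit S χ₀ γ (consistent_branchingTree S k ω hω) hfin h0
  have h := le_clock_iff S k t ω
  refine ⟨?_, fun n => first_step S χ₀ k hω (fun ht => ha ht _) (fun ht => ?_)⟩
  · by_cases ht : S.rate k * t ≤ (ω []).1
    · rw [aliveVal, if_pos ht]
      exact ha (h.2 ht) 0
    · rw [aliveVal, if_neg ht]
      exact (hd (not_le.1 (mt h.1 ht))).1
  · obtain ⟨hdie, hflip, hbranch⟩ := (hd ht).2 n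
    rcases root_cases S k hu with ⟨⟨a, b, c⟩, p0, p1, p2⟩ | ⟨⟨a, b, c⟩, p0, p1, p2, s0⟩ |
      ⟨⟨a, b, c⟩, p0, p1, p2, s1, s2⟩
    · rw [prunedOn, hdie p0 p1 p2]
      simp [stepVal, uInd, a, b, c]
    · rw [prunedOn, hflip (by simp [p0]) p1 p2, s0]
      simp [stepVal, uInd, a, b, c, prunedOn]
    · rw [prunedOn, hbranch _ _ p0 p1 p2, s1, s2]
      simp [stepVal, uInd, a, b, c, prunedOn]

theorem ae_tendsto_approxOn (S : QuadSystem d r) (χ₀ : Site d → Val r) (γ : Site d → ℝ → Val r)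
    (n : ℕ) (k : Site d) {t : ℝ} (ht : 0 ≤ t) :
    ∀ᵐ ω ∂(noiseLaw S), Tendsto (fun N => approxOn S χ₀ γ N n k t ω) atTop
      (nhds (prunedOn S χ₀ γ n k t ω)) := by
  filter_upwards [ae_clock_nonneg S, ae_finite_bornBefore S k ht] with ω hω hfin
  refine tendsto_const_nhds.congr' ?_
  filter_upwards [eventually_evalApprox_eq S χ₀ γ (consistent_branchingTree S k ω hω) hfin n]
    with N hN using hN.symm

/-! ### Moment bounds and the mild equation for bounded measurable forcing -/

theorem measurePreserving_clock (S : QuadSystem d r) :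
    MeasurePreserving (fun ω : Noise d => (ω []).1) (noiseLaw S)
      (ProbabilityTheory.expMeasure 1) :=
  measurePreserving_fst.comp (measurePreserving_eval_infinitePi (fun _ : Label => markLaw S) [])

theorem enorm_aliveVal_le (S : QuadSystem d r) {χ₀ : Site d → Val r} {K : ℝ}
    (hK : ∀ k, ‖χ₀ k‖ ≤ K) (k : Site d) (t : ℝ) (ω : Noise d) :
    ‖aliveVal S χ₀ k t ω‖ₑ ≤ ENNReal.ofReal K := by
  rw [← ofReal_norm]
  refine ENNReal.ofReal_le_ofReal ?_
  unfold aliveVal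
  split_ifs
  · exact hK k
  · simpa using (norm_nonneg _).trans (hK k)

theorem measurable_aliveVal (S : QuadSystem d r) (χ₀ : Site d → Val r) (k : Site d) (t : ℝ) :
    Measurable (aliveVal S χ₀ k t) :=
  Measurable.ite (measurableSet_le measurable_const (measurable_pi_apply []).fst)
    measurable_const measurable_const

theorem integral_aliveVal (S : QuadSystem d r) (χ₀ : Site d → Val r) (k : Site d) {t : ℝ}
    (ht : 0 ≤ t) :
    ∫ ω, aliveVal S χ₀ k t ω ∂(noiseLaw S) = Real.exp (-(S.rate k * t)) • χ₀ k := by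
  classical
  have hlt : 0 ≤ S.rate k * t := mul_nonneg (S.rate_pos k).le ht
  have hm : Measurable fun x : ℝ => if S.rate k * t ≤ x then χ₀ k else 0 :=
    Measurable.ite (measurableSet_le measurable_const measurable_id)
      measurable_const measurable_const
  have h1 := integral_map (μ := noiseLaw S) (measurePreserving_clock S).aemeasurable
    (f := fun x : ℝ => if S.rate k * t ≤ x then χ₀ k else 0) hm.aestronglyMeasurable
  rw [(measurePreserving_clock S).map_eq, integral_expMeasure] at h1
  have h2 : ∫ ω, aliveVal S χ₀ k t ω ∂(noiseLaw S) =
      ∫ ω, (if S.rate k * t ≤ (ω []).1 then χ₀ k else 0) ∂(noiseLaw S) := by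
    congr 1
  rw [h2, ← h1]
  have h3 : ∀ x : ℝ, Real.exp (-x) • (if S.rate k * t ≤ x then χ₀ k else 0) =
      (Ici (S.rate k * t)).indicator (fun x => Real.exp (-x) • χ₀ k) x := by
    intro x
    rw [indicator_apply]
    simp only [mem_Ici]
    split_ifs <;> simp
  simp only [h3]
  rw [setIntegral_indicator measurableSet_Ici, Ici_inter_Ici, sup_eq_right.2 hlt,
    integral_Ici_eq_integral_Ioi, integral_smul_const, integral_exp_neg_Ioi]

section Bounded

variable (S : QuadSystem d r) {χ₀ : Site d → Val r} {γ : Site d → ℝ → Val r} {K C : ℝ}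

/-- The bound `M₀` at level `n` is a constant coefficient at level `n + 1`, so the estimate there is
linear and global on `[0, T]`. Both `β` and the resulting bound depend on the level. -/
theorem exists_approxOn_bound (hγ : ∀ k, Measurable (γ k)) (hC : ∀ k s, ‖γ k s‖ ≤ C)
    (hK : ∀ k, ‖χ₀ k‖ ≤ K) (hC0 : 0 ≤ C) (hK0 : 0 ≤ K) (T : ℝ) (n : ℕ) :
    ∃ M, 0 ≤ M ∧ ∀ N k t, 0 ≤ t → t ≤ T →
      ∫⁻ ω, ‖approxOn S χ₀ γ N n k t ω‖ₑ ∂(noiseLaw S) ≤ ENNReal.ofReal M := by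
  induction n with
  | zero =>
    refine ⟨K, hK0, fun N k t _ _ => ?_⟩
    rcases N with _ | N
    · simp [approxOn, evalApprox]
    · calc _ ≤ ∫⁻ _, ENNReal.ofReal K ∂(noiseLaw S) := lintegral_mono fun ω => by
            rw [approxOn_zero_right]
            exact enorm_aliveVal_le S hK k t ω
        _ = _ := by simp
  | succ n ih =>
    obtain ⟨M₀, hM₀, hb⟩ := ih
    have hA : 0 ≤ S.Cf + S.Cb * M₀ := add_nonneg S.Cf_nonneg (mul_nonneg S.Cb_nonneg hM₀)
    obtain ⟨β, hβ, hcon⟩ := S.exists_contraction hA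
    -- The constant `2(K + C)` is a fixed point of the estimate: the root contributes `K`, the
    -- forcing `C`, and the subtrees half of `2(K + C)`.
    have key (N : ℕ) : ∀ k t, 0 ≤ t → t ≤ T →
        ∫⁻ ω, ‖approxOn S χ₀ γ N (n + 1) k t ω‖ₑ ∂(noiseLaw S) ≤
          ENNReal.ofReal (2 * (K + C) * Real.exp (β * t)) := by
      induction N with
      | zero =>
        intro k t _ _
        simp [approxOn, evalApprox]
      | succ N ihN =>
        intro k t ht htT
        have hl := S.rate_pos k
        have hpq : 0 ≤ S.p k + S.qtot k := add_nonneg (S.p_mem k).1 (S.qtot_nonneg k)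
        have hGm := measurable_stepVal S hγ
          (measurable_approxOn S χ₀ hγ N (n + 1)) (measurable_approxOn S χ₀ hγ N n) k
        have hren := lintegral_enorm_renewal_le (restLaw S k) (t := t) hGm.stronglyMeasurable hl
          (b := C + (S.Cf + S.Cb * M₀) * (S.p k + S.qtot k) * (2 * (K + C))) (by positivity) hβ
          fun s hs hst => by
            refine (lintegral_stepVal_le S (measurable_approxOn S χ₀ hγ N (n + 1))
              (measurable_approxOn S χ₀ hγ N n) k (by positivity) hM₀ (hC k s)
              (fun l => ihN l s hs (hst.trans htT))
              (fun m => hb N m s hs (hst.trans htT))).trans ?_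
            refine ENNReal.ofReal_le_ofReal ?_
            rw [add_mul C, ← mul_assoc]
            refine add_le_add (le_mul_of_one_le_right hC0 ?_) le_rfl
            exact Real.one_le_exp (mul_nonneg hβ hs)
        have hrm := (stronglyMeasurable_renewal (lam := S.rate k) (t := t)
          hGm.stronglyMeasurable).measurable.enorm
        calc _ ≤ ∫⁻ ω, (ENNReal.ofReal K + ‖renewal (stepVal S γ (approxOn S χ₀ γ N (n + 1))
              (approxOn S χ₀ γ N n) k) (S.rate k) t ((ω []).1, rest k ω)‖ₑ) ∂(noiseLaw S) := by
              refine lintegral_mono_ae ?_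
              filter_upwards [ae_approxOn_succ S χ₀ γ N n k t] with ω hω
              rw [hω]
              exact (enorm_add_le _ _).trans (add_le_add (enorm_aliveVal_le S hK k t ω) le_rfl)
          _ = ENNReal.ofReal K + ∫⁻ x, ‖renewal (stepVal S γ (approxOn S χ₀ γ N (n + 1))
              (approxOn S χ₀ γ N n) k) (S.rate k) t x‖ₑ
                ∂((ProbabilityTheory.expMeasure 1).prod (restLaw S k)) := by
              rw [lintegral_add_left measurable_const, lintegral_const, measure_univ, mul_one,
                ← (measurePreserving_root S k).lintegral_comp hrm]
          _ ≤ ENNReal.ofReal K + _ := add_le_add le_rfl hren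
          _ ≤ _ := by
              rw [← ENNReal.ofReal_add hK0 (by positivity)]
              refine ENNReal.ofReal_le_ofReal ?_
              have he : 1 ≤ Real.exp (β * t) := Real.one_le_exp (mul_nonneg hβ ht)
              have hfrac : S.rate k / (S.rate k + β) ≤ 1 :=
                (div_le_one (by positivity)).2 (by linarith)
              have h1 : (C + (S.Cf + S.Cb * M₀) * (S.p k + S.qtot k) * (2 * (K + C))) *
                  (S.rate k / (S.rate k + β)) ≤ C + (K + C) := by
                rw [add_mul, mul_right_comm]
                refine add_le_add (mul_le_of_le_one_right hC0 hfrac) ?_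
                have := mul_le_mul_of_nonneg_right (hcon k) (by positivity : 0 ≤ 2 * (K + C))
                linarith
              have h2 := mul_le_mul_of_nonneg_right h1 (Real.exp_nonneg (β * t))
              have h3 := le_mul_of_one_le_right hK0 he
              linarith
    refine ⟨2 * (K + C) * Real.exp (β * T), by positivity, fun N k t ht htT => ?_⟩
    refine (key N k t ht htT).trans (ENNReal.ofReal_le_ofReal ?_)
    gcongr

/-- Fatou's lemma applies, since the approximations converge almost surely and their bound does not
depend on the depth. -/
theorem exists_prunedOn_bound (hγ : ∀ k, Measurable (γ k)) (hC : ∀ k s, ‖γ k s‖ ≤ C)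
    (hK : ∀ k, ‖χ₀ k‖ ≤ K) (hC0 : 0 ≤ C) (hK0 : 0 ≤ K) (T : ℝ) (n : ℕ) :
    ∃ M, 0 ≤ M ∧ ∀ k t, 0 ≤ t → t ≤ T →
      ∫⁻ ω, ‖prunedOn S χ₀ γ n k t ω‖ₑ ∂(noiseLaw S) ≤ ENNReal.ofReal M := by
  obtain ⟨M, hM, h⟩ := exists_approxOn_bound S hγ hC hK hC0 hK0 T n
  refine ⟨M, hM, fun k t ht htT => ?_⟩
  calc _ = ∫⁻ ω, liminf (fun N => ‖approxOn S χ₀ γ N n k t ω‖ₑ) atTop ∂(noiseLaw S) := by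
        refine lintegral_congr_ae ?_
        filter_upwards [ae_tendsto_approxOn S χ₀ γ n k ht] with ω hω
        exact hω.enorm.liminf_eq.symm
    _ ≤ liminf (fun N => ∫⁻ ω, ‖approxOn S χ₀ γ N n k t ω‖ₑ ∂(noiseLaw S)) atTop :=
        lintegral_liminf_le fun N => (measurable_slice (measurable_approxOn S χ₀ hγ N n k) t).enorm
    _ ≤ ENNReal.ofReal M := liminf_le_of_le (by isBoundedDefault) fun b hb => by
        obtain ⟨N, hN⟩ := hb.exists
        exact hN.trans (h N k t ht htT)

theorem prunedExpectation_eq (hγ : ∀ k, Measurable (γ k)) (n : ℕ) (k : Site d) (t : ℝ) :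
    prunedExpectation S χ₀ γ n k t = ∫ ω, prunedOn S χ₀ γ n k t ω ∂(noiseLaw S) :=
  integral_map (measurable_branchingTree S k).aemeasurable
    ((measurable_prunedEval S χ₀ hγ n).comp measurable_prodMk_left).aestronglyMeasurable

theorem integrable_prunedEval (hγ : ∀ k, Measurable (γ k)) (hC : ∀ k s, ‖γ k s‖ ≤ C)
    (hK : ∀ k, ‖χ₀ k‖ ≤ K) (n : ℕ) (k : Site d) {t : ℝ} (ht : 0 ≤ t) :
    Integrable (prunedEval S χ₀ γ n t) (treeLaw S k) := by
  have hC0 : 0 ≤ C := (norm_nonneg _).trans (hC k 0)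
  have hK0 : 0 ≤ K := (norm_nonneg _).trans (hK k)
  obtain ⟨M, _, h⟩ := exists_prunedOn_bound S hγ hC hK hC0 hK0 t n
  have hm : Measurable (prunedEval S χ₀ γ n t) :=
    (measurable_prunedEval S χ₀ hγ n).comp measurable_prodMk_left
  rw [treeLaw, integrable_map_measure hm.aestronglyMeasurable
    (measurable_branchingTree S k).aemeasurable]
  exact ⟨(hm.comp (measurable_branchingTree S k)).aestronglyMeasurable,
    (h k t ht le_rfl).trans_lt ENNReal.ofReal_lt_top⟩

theorem norm_prunedExpectation_le (hγ : ∀ k, Measurable (γ k)) {n : ℕ} {k : Site d} {t M : ℝ}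
    (hM : 0 ≤ M) (h : ∫⁻ ω, ‖prunedOn S χ₀ γ n k t ω‖ₑ ∂(noiseLaw S) ≤ ENNReal.ofReal M) :
    ‖prunedExpectation S χ₀ γ n k t‖ ≤ M := by
  have h2 := (enorm_integral_le_lintegral_enorm (μ := noiseLaw S)
    (fun ω => prunedOn S χ₀ γ n k t ω)).trans h
  rwa [← ofReal_norm, ENNReal.ofReal_le_ofReal_iff hM, ← prunedExpectation_eq S hγ] at h2

theorem summable_quadTerm (k : Site d) {u v : Site d → Val r} {a b : ℝ} (hu : ∀ l, ‖u l‖ ≤ a)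
    (hv : ∀ m, ‖v m‖ ≤ b) : Summable (quadTerm S k u v) := by
  refine Summable.of_norm_bounded (g := fun lm => S.q k lm.1 lm.2 * (a * b))
    ((S.q_summable k).mul_right _) fun lm => ?_
  rw [quadTerm, norm_smul, Real.norm_of_nonneg (S.q_mem _ _ _).1]
  refine mul_le_mul_of_nonneg_left ((S.norm_B_le _ _ _ _ _).trans ?_) (S.q_mem _ _ _).1
  exact mul_le_mul (hu _) (hv _) (norm_nonneg _) ((norm_nonneg _).trans (hu lm.1))

/-- Taking expectations in the first-step identity, the event that the root survives gives `e^{-λ_k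
t} χ_k(0)` and the first ring gives the integral of the averaged step. -/
theorem isMildSchemeSolution_prunedExpectation (hγ : ∀ k, Measurable (γ k))
    (hC : ∀ k s, ‖γ k s‖ ≤ C) (hK : ∀ k, ‖χ₀ k‖ ≤ K) (T : ℝ) :
    IsMildSchemeSolution S χ₀ γ T (prunedExpectation S χ₀ γ) := by
  have hC0 : 0 ≤ C := (norm_nonneg _).trans (hC 0 0)
  have hK0 : 0 ≤ K := (norm_nonneg _).trans (hK 0)
  have hbound := exists_prunedOn_bound S hγ hC hK hC0 hK0 T
  choose M hM hMb using hbound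
  have hnorm (n : ℕ) (k : Site d) (t : ℝ) (ht : t ∈ Icc 0 T) :
      ‖prunedExpectation S χ₀ γ n k t‖ ≤ M n :=
    norm_prunedExpectation_le S hγ (hM n) (hMb n k t ht.1 ht.2)
  have hstep (n : ℕ) (k : Site d) (t : ℝ) (ht : t ∈ Icc 0 T) :
      IntervalIntegrable (mildSource S γ (prunedExpectation S χ₀ γ (n + 1))
        (prunedExpectation S χ₀ γ n) k t) volume 0 t ∧
      prunedExpectation S χ₀ γ (n + 1) k t = Real.exp (-(S.rate k * t)) • χ₀ k
        + ∫ s in (0 : ℝ)..t, mildSource S γ (prunedExpectation S χ₀ γ (n + 1))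
          (prunedExpectation S χ₀ γ n) k t s := by
    have hl := S.rate_pos k
    set X := prunedOn S χ₀ γ (n + 1)
    set Y := prunedOn S χ₀ γ n
    have hXm := measurable_prunedOn S χ₀ hγ (n + 1)
    have hYm := measurable_prunedOn S χ₀ hγ n
    have hG := (measurable_stepVal S hγ hXm hYm k).stronglyMeasurable
    have hpq : 0 ≤ S.p k + S.qtot k := add_nonneg (S.p_mem k).1 (S.qtot_nonneg k)
    have hA : 0 ≤ S.Cf + S.Cb * M n := add_nonneg S.Cf_nonneg (mul_nonneg S.Cb_nonneg (hM n))
    have hM1 := hM (n + 1)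
    have hL : 0 ≤ C + (S.Cf + S.Cb * M n) * (S.p k + S.qtot k) * M (n + 1) := by positivity
    have hGb : ∀ s, 0 ≤ s → s ≤ t → ∫⁻ z, ‖stepVal S γ X Y k s z‖ₑ ∂(restLaw S k) ≤
        ENNReal.ofReal (C + (S.Cf + S.Cb * M n) * (S.p k + S.qtot k) * M (n + 1)) :=
      fun s hs hst => lintegral_stepVal_le S hXm hYm k hM1 (hM n) (hC k s)
        (fun l => hMb (n + 1) l s hs (hst.trans ht.2)) (fun m => hMb n m s hs (hst.trans ht.2))
    have hsrc : ∀ s ∈ Icc 0 t, renewalSource (restLaw S k) (stepVal S γ X Y k) (S.rate k) t s =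
        mildSource S γ (prunedExpectation S χ₀ γ (n + 1)) (prunedExpectation S χ₀ γ n) k t s := by
      intro s hs
      rw [renewalSource, integral_stepVal S hXm hYm k hM1
        (fun l => hMb (n + 1) l s hs.1 (hs.2.trans ht.2))
        (fun m => hMb n m s hs.1 (hs.2.trans ht.2)), mildSource]
      simp only [prunedExpectation_eq S hγ]
    have hii := intervalIntegrable_renewalSource (restLaw S k) hG hl ht.1 hL hGb
    have hint := integral_renewal (restLaw S k) hG hl ht.1 hL hGb
    have hri := integrable_renewal (restLaw S k) hG hl hL hGb
    refine ⟨hii.congr fun s hs => hsrc s ?_, ?_⟩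
    · rw [uIoc_of_le ht.1] at hs
      exact ⟨hs.1.le, hs.2⟩
    · have hroot : Integrable (fun ω => renewal (stepVal S γ X Y k) (S.rate k) t
          ((ω []).1, rest k ω)) (noiseLaw S) :=
        (measurePreserving_root S k).integrable_comp_of_integrable hri
      have halive : Integrable (aliveVal S χ₀ k t) (noiseLaw S) := by
        refine ⟨(measurable_aliveVal S χ₀ k t).aestronglyMeasurable, ?_⟩
        refine (lintegral_mono fun ω => enorm_aliveVal_le S hK k t ω).trans_lt ?_
        simp
      have hmap := integral_map (μ := noiseLaw S) (measurePreserving_root S k).aemeasurable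
        (f := renewal (stepVal S γ X Y k) (S.rate k) t)
        (stronglyMeasurable_renewal hG).aestronglyMeasurable
      rw [(measurePreserving_root S k).map_eq] at hmap
      calc _ = ∫ ω, (aliveVal S χ₀ k t ω + renewal (stepVal S γ X Y k) (S.rate k) t
            ((ω []).1, rest k ω)) ∂(noiseLaw S) := by
            rw [prunedExpectation_eq S hγ]
            refine integral_congr_ae ?_
            filter_upwards [ae_prunedOn S χ₀ γ k ht.1] with ω hω using hω.2 n
        _ = _ := by
            rw [integral_add halive hroot, integral_aliveVal S χ₀ k ht.1, ← hmap, hint]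
            congr 1
            refine intervalIntegral.integral_congr fun s hs => hsrc s ?_
            rwa [uIcc_of_le ht.1] at hs
  refine ⟨fun n => ⟨fun k => ?_, M n, ?_⟩, fun k t ht => ?_, fun n k => ?_,
    fun n k t ht => (hstep n k t ht).1, fun n k t ht => (hstep n k t ht).2⟩
  · have h1 : prunedExpectation S χ₀ γ n k =
        fun t => ∫ ω, prunedOn S χ₀ γ n k t ω ∂(noiseLaw S) :=
      funext fun t => prunedExpectation_eq S hγ n k t
    rw [h1]
    exact ((measurable_prunedOn S χ₀ hγ n k).stronglyMeasurable.integral_prod_right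
      (ν := noiseLaw S)).aestronglyMeasurable
  · filter_upwards [ae_restrict_mem measurableSet_Icc] with t ht k using hnorm n k t ht
  · rw [prunedExpectation_eq S hγ, ← integral_aliveVal S χ₀ k ht.1]
    refine integral_congr_ae ?_
    filter_upwards [ae_prunedOn S χ₀ γ k ht.1] with ω hω using hω.1
  · filter_upwards [ae_restrict_mem measurableSet_Icc] with s hs
    exact summable_quadTerm S k (fun l => hnorm (n + 1) l s hs) fun m => hnorm n m s hs

end Bounded

/-! ### Uniqueness -/

/-- The factor `λ/(λ+β)` now arises from the mild kernel. The integrand has an explicit primitive,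
whose nonnegative value at `0` is dropped. -/
theorem integral_exp_mul_exp_le {lam β t : ℝ} (hl : 0 < lam) (hβ : 0 ≤ β) :
    ∫ s in (0 : ℝ)..t, lam * Real.exp (-(lam * (t - s))) * Real.exp (β * s) ≤
      lam / (lam + β) * Real.exp (β * t) := by
  have hlb : 0 < lam + β := by positivity
  have hderiv : ∀ s ∈ uIcc 0 t, HasDerivAt
      (fun s => lam / (lam + β) * Real.exp (-(lam * (t - s)) + β * s))
      (lam * Real.exp (-(lam * (t - s))) * Real.exp (β * s)) s := by
    intro s _
    have h1 : HasDerivAt (fun s => -(lam * (t - s)) + β * s) (lam + β) s := by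
      have h2 : HasDerivAt (fun s => -(lam * (t - s)) + β * s) (-(lam * -1) + β * 1) s :=
        (((hasDerivAt_id s).const_sub t).const_mul lam).neg.add ((hasDerivAt_id s).const_mul β)
      simpa using h2
    convert! h1.exp.const_mul (lam / (lam + β)) using 1
    rw [Real.exp_add]
    field_simp
  rw [intervalIntegral.integral_eq_sub_of_hasDerivAt hderiv
    (Continuous.intervalIntegrable (by fun_prop) _ _)]
  have h3 : 0 ≤ lam / (lam + β) * Real.exp (-(lam * (t - 0)) + β * 0) := by positivity
  simp only [sub_self, mul_zero, neg_zero, zero_add] at h3 ⊢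
  linarith

theorem norm_tsum_quadTerm_le (S : QuadSystem d r) (k : Site d) {u v : Site d → Val r} {a b : ℝ}
    (hu : ∀ l, ‖u l‖ ≤ a) (hv : ∀ m, ‖v m‖ ≤ b) :
    ‖∑' lm, quadTerm S k u v lm‖ ≤ S.qtot k * (a * b) := by
  refine tsum_of_norm_bounded (g := fun lm => S.q k lm.1 lm.2 * (a * b))
    ((S.q_summable k).hasSum.mul_right _) fun lm => ?_
  rw [quadTerm, norm_smul, Real.norm_of_nonneg (S.q_mem _ _ _).1]
  refine mul_le_mul_of_nonneg_left ((S.norm_B_le _ _ _ _ _).trans ?_) (S.q_mem _ _ _).1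
  exact mul_le_mul (hu _) (hv _) (norm_nonneg _) ((norm_nonneg _).trans (hu lm.1))

/-- With a common second argument the forcing cancels and the bilinear term is linear in the
difference: this is where the semi-implicit form of the scheme helps. -/
theorem norm_mildSource_sub_le (S : QuadSystem d r) (γ : Site d → ℝ → Val r)
    {u u' v : Site d → ℝ → Val r} (k : Site d) (t : ℝ) {s a b : ℝ} (hb : 0 ≤ b)
    (hs : Summable (quadTerm S k (fun l => u l s) fun m => v m s))
    (hs' : Summable (quadTerm S k (fun l => u' l s) fun m => v m s))
    (ha : ∀ l, ‖u l s - u' l s‖ ≤ a) (hv : ∀ m, ‖v m s‖ ≤ b) :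
    ‖mildSource S γ u v k t s - mildSource S γ u' v k t s‖ ≤
      S.rate k * Real.exp (-(S.rate k * (t - s))) *
        ((S.Cf + S.Cb * b) * (S.p k + S.qtot k) * a) := by
  have hp := (S.p_mem k).1
  have hq := S.qtot_nonneg k
  have hCf := S.Cf_nonneg
  have hCb := S.Cb_nonneg
  have ha0 : 0 ≤ a := (norm_nonneg _).trans (ha k)
  have hsub : (∑' lm, quadTerm S k (fun l => u l s) (fun m => v m s) lm) -
      ∑' lm, quadTerm S k (fun l => u' l s) (fun m => v m s) lm =
        ∑' lm, quadTerm S k (fun l => u l s - u' l s) (fun m => v m s) lm := by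
    rw [← hs.tsum_sub hs']
    refine tsum_congr fun lm => ?_
    simp only [quadTerm, map_sub, LinearMap.sub_apply, smul_sub]
  have hdiff : mildSource S γ u v k t s - mildSource S γ u' v k t s =
      (S.rate k * Real.exp (-(S.rate k * (t - s)))) • ((S.Cf * S.p k) • (u k s - u' k s) +
        S.Cb • ∑' lm, quadTerm S k (fun l => u l s - u' l s) (fun m => v m s) lm) := by
    rw [← hsub, mildSource, mildSource, ← smul_sub, smul_sub (S.Cf * S.p k), smul_sub S.Cb]
    congr 1
    abel
  have hrate : 0 ≤ S.rate k * Real.exp (-(S.rate k * (t - s))) :=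
    mul_nonneg (S.rate_pos k).le (Real.exp_nonneg _)
  rw [hdiff, norm_smul, Real.norm_of_nonneg hrate]
  refine mul_le_mul_of_nonneg_left ((norm_add_le _ _).trans ?_) hrate
  rw [norm_smul, norm_smul, Real.norm_of_nonneg (mul_nonneg hCf hp), Real.norm_of_nonneg hCb]
  have h1 := mul_le_mul_of_nonneg_left (ha k) (mul_nonneg hCf hp)
  have h2 := mul_le_mul_of_nonneg_left (norm_tsum_quadTerm_le S k ha hv) hCb
  have h3 : 0 ≤ S.Cf * S.qtot k * a := by positivity
  have h4 : 0 ≤ S.Cb * b * S.p k * a := by positivity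
  nlinarith

theorem mildSource_congr (S : QuadSystem d r) {γ γ' u u' v v' : Site d → ℝ → Val r} (k : Site d)
    (t : ℝ) {s : ℝ} (hγ : ∀ k, γ k s = γ' k s) (hu : ∀ k, u k s = u' k s)
    (hv : ∀ k, v k s = v' k s) : mildSource S γ u v k t s = mildSource S γ' u' v' k t s := by
  simp only [mildSource, hγ, hu, hv]

/-- The forcing enters only under integrals, so it may change on a null set of times. The mild
equation is imposed at every time, so the solutions must agree everywhere on the interval. -/
theorem IsMildSchemeSolution.congr {S : QuadSystem d r} {χ₀ : Site d → Val r}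
    {γ γ' : Site d → ℝ → Val r} {T : ℝ} {χ χ' : ℕ → Site d → ℝ → Val r}
    (h : IsMildSchemeSolution S χ₀ γ T χ)
    (hγ : ∀ᵐ s ∂(volume.restrict (Icc 0 T)), ∀ k, γ k s = γ' k s)
    (hχ : ∀ n k, ∀ t ∈ Icc 0 T, χ n k t = χ' n k t) : IsMildSchemeSolution S χ₀ γ' T χ' := by
  have hae : ∀ᵐ s ∂(volume.restrict (Icc 0 T)), (∀ k, γ k s = γ' k s) ∧
      ∀ n k, χ n k s = χ' n k s := by
    filter_upwards [hγ, ae_restrict_mem measurableSet_Icc] with s h1 h2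
    exact ⟨h1, fun n k => hχ n k s h2⟩
  have hsrc (n : ℕ) (k : Site d) (t : ℝ) (ht : t ∈ Icc 0 T) :
      ∀ᵐ s ∂(volume.restrict (uIoc 0 t)), mildSource S γ (χ (n + 1)) (χ n) k t s =
        mildSource S γ' (χ' (n + 1)) (χ' n) k t s := by
    rw [uIoc_of_le ht.1]
    have hsub : Ioc 0 t ⊆ Icc 0 T := fun s hs => ⟨hs.1.le, hs.2.trans ht.2⟩
    filter_upwards [ae_mono (Measure.restrict_mono hsub le_rfl) hae] with s hs
    exact mildSource_congr S k t hs.1 (hs.2 _) (hs.2 _)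
  refine ⟨fun n => ⟨fun k => ?_, ?_⟩, fun k t ht => ?_, fun n k => ?_, fun n k t ht => ?_,
    fun n k t ht => ?_⟩
  · refine ((h.memLinfty n).1 k).congr ?_
    filter_upwards [hae] with s hs using hs.2 n k
  · obtain ⟨C, hC⟩ := (h.memLinfty n).2
    refine ⟨C, ?_⟩
    filter_upwards [hae, hC] with s hs hCs k
    rw [← hs.2 n k]
    exact hCs k
  · rw [← hχ 0 k t ht, h.zero_eq k t ht]
  · filter_upwards [hae, h.summable n k] with s hs hsum
    simpa only [hs.2] using hsum
  · exact (h.integrable n k t ht).congr_ae (hsrc n k t ht)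
  · rw [← hχ (n + 1) k t ht, h.succ_eq n k t ht]
    congr 1
    refine intervalIntegral.integral_congr_ae ?_
    exact (ae_restrict_iff' measurableSet_uIoc).1 (hsrc n k t ht)

/-- Once level `n` is identified, the difference at level `n + 1` solves a homogeneous linear mild
equation, and its norm weighted by `e^{-βt}` is at most half of itself. -/
theorem IsMildSchemeSolution.unique {S : QuadSystem d r} {χ₀ : Site d → Val r}
    {γ : Site d → ℝ → Val r} {T : ℝ} {χ χ' : ℕ → Site d → ℝ → Val r}
    (h : IsMildSchemeSolution S χ₀ γ T χ) (h' : IsMildSchemeSolution S χ₀ γ T χ') (n : ℕ) :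
    ∀ k, ∀ t ∈ Icc 0 T, χ n k t = χ' n k t := by
  induction n with
  | zero => exact fun k t ht => (h.zero_eq k t ht).trans (h'.zero_eq k t ht).symm
  | succ n ih =>
    obtain ⟨a, ha⟩ := (h.memLinfty (n + 1)).2
    obtain ⟨a', ha'⟩ := (h'.memLinfty (n + 1)).2
    obtain ⟨b, hb⟩ := (h.memLinfty n).2
    have hA : 0 ≤ S.Cf + S.Cb * |b| :=
      add_nonneg S.Cf_nonneg (mul_nonneg S.Cb_nonneg (abs_nonneg b))
    obtain ⟨β, hβ, hcon⟩ := S.exists_contraction hA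
    -- An almost-everywhere bound goes in and a bound at every time comes out, because the equation
    -- itself holds at every time.
    have hstep (D : ℝ) (hD0 : 0 ≤ D) (hD : ∀ᵐ s ∂(volume.restrict (Icc 0 T)), ∀ k,
        ‖χ (n + 1) k s - χ' (n + 1) k s‖ ≤ D * Real.exp (β * s)) (k : Site d) (t : ℝ)
        (ht : t ∈ Icc 0 T) :
        ‖χ (n + 1) k t - χ' (n + 1) k t‖ ≤ D / 2 * Real.exp (β * t) := by
      have hl := S.rate_pos k
      have hsub : Ioc 0 t ⊆ Icc 0 T := fun s hs => ⟨hs.1.le, hs.2.trans ht.2⟩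
      have hae : ∀ᵐ s ∂(volume.restrict (Icc 0 T)),
          ‖mildSource S γ (χ (n + 1)) (χ n) k t s - mildSource S γ (χ' (n + 1)) (χ' n) k t s‖ ≤
            (S.Cf + S.Cb * |b|) * (S.p k + S.qtot k) * D *
              (S.rate k * Real.exp (-(S.rate k * (t - s))) * Real.exp (β * s)) := by
        filter_upwards [hD, hb, h.summable n k, h'.summable n k,
          ae_restrict_mem measurableSet_Icc] with s h1 h2 h3 h4 hs
        have heq : ∀ m, χ' n m s = χ n m s := fun m => (ih m s hs).symm
        simp only [heq] at h4
        rw [mildSource_congr S (γ' := γ) (u' := χ' (n + 1)) (v := χ' n) (v' := χ n) k t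
          (fun _ => rfl) (fun _ => rfl) heq]
        refine (norm_mildSource_sub_le S γ k t (abs_nonneg b) h3 h4 h1
          fun m => (h2 m).trans (le_abs_self b)).trans_eq ?_
        ring
      rw [h.succ_eq n k t ht, h'.succ_eq n k t ht, add_sub_add_left_eq_sub,
        ← intervalIntegral.integral_sub (h.integrable n k t ht) (h'.integrable n k t ht)]
      refine (intervalIntegral.norm_integral_le_of_norm_le ht.1
        ((ae_restrict_iff' measurableSet_Ioc).1 (ae_mono (Measure.restrict_mono hsub le_rfl) hae))
        (Continuous.intervalIntegrable (by fun_prop) _ _)).trans ?_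
      rw [intervalIntegral.integral_const_mul]
      have hpq : 0 ≤ S.p k + S.qtot k := add_nonneg (S.p_mem k).1 (S.qtot_nonneg k)
      calc _ ≤ (S.Cf + S.Cb * |b|) * (S.p k + S.qtot k) * D *
            (S.rate k / (S.rate k + β) * Real.exp (β * t)) :=
            mul_le_mul_of_nonneg_left (integral_exp_mul_exp_le hl hβ) (by positivity)
        _ = ((S.Cf + S.Cb * |b|) * (S.p k + S.qtot k) * (S.rate k / (S.rate k + β))) *
            (D * Real.exp (β * t)) := by ring
        _ ≤ 1 / 2 * (D * Real.exp (β * t)) :=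
            mul_le_mul_of_nonneg_right (hcon k) (by positivity)
        _ = _ := by ring
    have hiter (j : ℕ) : ∀ᵐ s ∂(volume.restrict (Icc 0 T)), ∀ k,
        ‖χ (n + 1) k s - χ' (n + 1) k s‖ ≤ (|a| + |a'|) / 2 ^ j * Real.exp (β * s) := by
      induction j with
      | zero =>
        filter_upwards [ha, ha', ae_restrict_mem measurableSet_Icc] with s h1 h2 hs k
        have h3 : 1 ≤ Real.exp (β * s) := Real.one_le_exp (mul_nonneg hβ hs.1)
        calc _ ≤ |a| + |a'| := (norm_sub_le _ _).trans
              (add_le_add ((h1 k).trans (le_abs_self a)) ((h2 k).trans (le_abs_self a')))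
          _ ≤ _ := by
              rw [pow_zero, div_one]
              exact le_mul_of_one_le_right (by positivity) h3
      | succ j ihj =>
        filter_upwards [ae_restrict_mem measurableSet_Icc] with s hs k
        have := hstep _ (by positivity) ihj k s hs
        rwa [div_div, ← pow_succ] at this
    intro k t ht
    have hlim : Tendsto (fun j : ℕ => (|a| + |a'|) / 2 ^ j / 2 * Real.exp (β * t)) atTop
        (nhds 0) := by
      have h1 : Tendsto (fun j : ℕ => (2 : ℝ) ^ j) atTop atTop :=
        tendsto_pow_atTop_atTop_of_one_lt (by norm_num)
      simpa using ((h1.const_div_atTop (|a| + |a'|)).div_const 2).mul_const (Real.exp (β * t))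
    -- One more application of `hstep` upgrades each iterated bound from almost every time to the
    -- given `t`.
    have h0 := ge_of_tendsto' hlim fun j => hstep _ (by positivity) (hiter j) k t ht
    exact sub_eq_zero.1 (norm_le_zero_iff.1 h0)

/-- An `L^∞` family agrees almost everywhere with a bounded, measurable one. -/
theorem MemLinfty.exists_bounded_measurable {T : ℝ} {γ : Site d → ℝ → Val r}
    (h : MemLinfty T γ) : ∃ γ' : Site d → ℝ → Val r, ∃ C, (∀ k, Measurable (γ' k)) ∧
      (∀ k s, ‖γ' k s‖ ≤ C) ∧ ∀ᵐ s ∂(volume.restrict (Icc 0 T)), ∀ k, γ' k s = γ k s := by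
  classical
  obtain ⟨hm, C, hC⟩ := h
  have hg (k : Site d) : Measurable ((hm k).mk (γ k)) :=
    (hm k).stronglyMeasurable_mk.measurable
  refine ⟨fun k s => if ‖(hm k).mk (γ k) s‖ ≤ |C| then (hm k).mk (γ k) s else 0, |C|,
    fun k => Measurable.ite (measurableSet_le (hg k).norm measurable_const) (hg k)
      measurable_const, fun k s => ?_, ?_⟩
  · dsimp only
    split_ifs with hs
    · exact hs
    · simp
  · filter_upwards [hC, ae_all_iff.2 fun k => (hm k).ae_eq_mk] with s h1 h2 k
    rw [← h2 k, if_pos ((h1 k).trans (le_abs_self C))]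

end PrunedTree

end

/-! ### Existence and uniqueness for general bounded forcing -/

theorem proposition5p1 {d r : ℕ} (S : PrunedTree.QuadSystem d r)
    (χ₀ : PrunedTree.Site d → PrunedTree.Val r)
    (γ : PrunedTree.Site d → ℝ → PrunedTree.Val r) (T : ℝ) (hT : 0 < T)
    (hχ₀ : Memℓp χ₀ ∞) (hγ : PrunedTree.MemLinfty T γ) :
    (∀ n k, ∀ t ∈ Icc 0 T,
      Integrable (PrunedTree.prunedEval S χ₀ γ n t) (PrunedTree.treeLaw S k)) ∧
    PrunedTree.IsMildSchemeSolution S χ₀ γ T (PrunedTree.prunedExpectation S χ₀ γ) ∧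
    ∀ χ : ℕ → PrunedTree.Site d → ℝ → PrunedTree.Val r,
      PrunedTree.IsMildSchemeSolution S χ₀ γ T χ →
      ∀ n k, ∀ t ∈ Icc 0 T, χ n k t = PrunedTree.prunedExpectation S χ₀ γ n k t := by
  obtain ⟨K, hK⟩ := memℓp_infty_iff.1 hχ₀
  have hK' : ∀ k, ‖χ₀ k‖ ≤ K := fun k => hK (mem_range_self k)
  obtain ⟨γ', C, hm, hC, hae⟩ := hγ.exists_bounded_measurable
  -- The regular version `γ'` of the forcing gives almost surely the same evaluations, hence the
  -- same expectations at every `t`, so its mild equation transfers to `γ`.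
  have hsol : PrunedTree.IsMildSchemeSolution S χ₀ γ T (PrunedTree.prunedExpectation S χ₀ γ) :=
    (PrunedTree.isMildSchemeSolution_prunedExpectation S hm hC hK' T).congr hae
      fun n k t ht => integral_congr_ae (PrunedTree.ae_prunedEval_congr S χ₀ hae n k ht.2)
  refine ⟨fun n k t ht => ?_, hsol, fun χ hχ n => hχ.unique hsol n⟩
  exact (PrunedTree.integrable_prunedEval S hm hC hK' n k ht.1).congr
    (PrunedTree.ae_prunedEval_congr S χ₀ hae n k ht.2)
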